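/- Let $\Bbbk$ be a field with $\operatorname{char}\Bbbk\neq 2$. A superspace is a finite-dimensional $\mathbb Z/2$-graded $\Bbbk$-vector space $M=M_0\oplus M_1$; $|v|$ denotes the parity of a homogeneous $v$, and $\Pi M$ is $M$ with the opposite grading. **Powers.** For $d\ge 0$ let the symmetric group $\mathfrak S_d$ act on the right of $M^{\otimes d}$ by $(v_1\otimes\cdots\otimes v_d).\sigma=\operatorname{sgn}(v,\sigma)\,v_{\sigma 1}\otimes\cdots\otimes v_{\sigma d}$ for homogeneous $v_i$, where $\operatorname{sgn}(v,\sigma)=\prod_{s<t,\ \sigma^{-1}s>\sigma^{-1}t}(-1)^{|v_s||v_t|}$. Let $S^dM$ be the degree $d$ part of the symmetric superalgebra $T(M)/\langle x\otimes y-(-1)^{|x||y|}y\otimes x\rangle$, with multiplication map $m:M^{\otimes d}\to S^dM$, and let $\Gamma^dM=(S^d(M^*))^*$. The dual of $m:(M^*)^{\otimes d}\to S^d(M^*)$ is an embedding $\Delta:\Gamma^dM\to ((M^*)^{\otimes d})^*= M^{\otimes d}$, where $v_1\otimes\cdots\otimes v_d$ is identified with the functional $f_1\otimes\cdots\otimes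 f_d\mapsto\prod_i f_i(v_i)$. If $(Z_1,\dots,Z_N)$ is a homogeneous basis of $M$ with dual basis $(\check Z_i)$, and $\boldsymbol i=(i_1\le\dots\le i_d)$ is a sequence in which no $i$ with $Z_i$ odd is repeated, then $Z^{(\boldsymbol i)}\in\Gamma^dM$ denotes the functional taking the value $1$ at $\check Z_{i_1}\cdots\check Z_{i_d}$ and $0$ at the monomials of all other such sequences. **Schur superfunctors.** Let $\mu\subseteq\lambda$ be partitions with conjugates $\mu'\subseteq\lambda'$, let $\lambda/\mu$ have $d$ boxes, $q$ rows and $r=\lambda_1$ columns, and put $$\Gamma_\Pi^{\lambda/\mu}(M)=\bigotimes_{i=1}^{q}\Gamma^{\lambda_i-\mu_i}(\Pi M),\qquad S^{\lambda'/\mu'}(M)=\bigotimes_{j=1}^{r}S^{\lambda'_j-\mu'_j}(M).$$ Let $\Delta_\Pi:\Gamma_\Pi^{\lambda/\mu}(M)\to(\Pi M)^{\otimes d}\to M^{\otimes d}$ be the tensor product of the maps $\Delta$ followed by $1^{\otimes d}$, where $1:\Pi M\to M$ is the odd identity map and the rule of signs is used: on homogeneous elements of $\Pi M$, $1^{\otimes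 d}(v_1\otimes\cdots\otimes v_d)=\prod_{s<t}(-1)^{|v_s|}\,v_1\otimes\cdots\otimes v_d$, with parities taken in $\Pi M$. Let $\sigma_{\lambda'/\mu'}\in\mathfrak S_d$ send the number of a box of $\lambda/\mu$ in the reading down the columns, left to right, to its number in the reading along the rows, top to bottom. Define $$\hat\theta_{\lambda'/\mu'}(M):\ \Gamma_\Pi^{\lambda/\mu}(M)\xrightarrow{\ \Delta_\Pi\ }M^{\otimes d}\xrightarrow{\ \cdot\,\sigma_{\lambda'/\mu'}\ }M^{\otimes d}\xrightarrow{\ m\ }S^{\lambda'/\mu'}(M),\qquad \widehat S_{\lambda'/\mu'}(M)=\operatorname{im}\hat\theta_{\lambda'/\mu'}(M),$$ where $m$ is the tensor product of the multiplication maps. Let $\mathcal C_1$ be the Clifford superalgebra with one odd generator $c$, $c^2=1$. For a finite-dimensional right $\mathcal C_1$-supermodule $V$ with underlying superspace $F_{\mathcal C}(V)$, put $\hat\theta^{\mathsf{II}}_{\lambda'/\mu'}(V)=\hat\theta_{\lambda'/\mu'}(F_{\mathcal C}(V))$ and $\widehat S^{\mathsf{II}}_{\lambda'/\mu'}(V)=\widehat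 S_{\lambda'/\mu'}(F_{\mathcal C}(V))$. **Tableaux.** Let $V$ be a finite-dimensional right $\mathcal C_1$-supermodule (so its superdimension is $n|n$ for some $n\ge0$), and let $Z=(Z_1,\dots,Z_{2n})$ be any $\mathbb Z/2$-homogeneous basis of $V$, in any order. Give $[n+n]=\{1,\dots,2n\}$ its usual order and call $i$ even or odd according to the parity of $Z_i$ in $V$. A tableau $\mathfrak t$ of shape $\lambda/\mu$ with entries in $[n+n]$ is costandard if the entries in each row are nondecreasing with only odd entries repeated, and the entries in each column are nondecreasing with only even entries repeated. For a costandard $\mathfrak t$ with rows $\mathfrak t^1,\dots,\mathfrak t^q$ (read left to right) put $Z_\Pi^{(\mathfrak t)}=\bigotimes_{i=1}^q(\Pi Z)^{(\mathfrak t^i)}\in\Gamma_\Pi^{\lambda/\mu}(F_{\mathcal C}(V))$, where $\Pi Z$ is the basis $Z$ regarded as a homogeneous basis of $\Pi V$. **Claim.** For all partitions $\mu\subseteq\lambda$, every such $V$ and every such basis $Z$, the elements $\hat\theta^{\mathsf{II}}_{\lambda'/\mu'}(V)\big(Z_\Pi^{(\mathfrak t)}\big)$, indexed by the costandard tableaux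 $\mathfrak t$ of shape $\lambda/\mu$ with entries in $[n+n]$, form a basis of $\widehat S^{\mathsf{II}}_{\lambda'/\mu'}(V)$. -/

import Mathlib

universe u v

open scoped TensorProduct

noncomputable section

namespace SuperSchur

/-- The sign `(-1)^(a b)` of the rule of signs. -/
def koszul (a b : ZMod 2) : ℤ := if a = 1 ∧ b = 1 then -1 else 1

section Powers

variable {k : Type u} [Field k] {M : Type v} [AddCommGroup M] [Module k M]

/-- The homogeneous projection `M → M_ε ⊆ M` of a superspace `M = M_0 ⊕ M_1`. -/
def superProj (G : ZMod 2 → Submodule k M) [DirectSum.Decomposition G] (ε : ZMod 2) :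
    M →ₗ[k] M :=
  (G ε).subtype ∘ₗ DirectSum.component k (ZMod 2) (fun i => G i) ε ∘ₗ
    (DirectSum.decomposeLinearEquiv G).toLinearMap

/-- The grading of `ΠM`: the same vector space with the opposite grading. -/
def parityShift (G : ZMod 2 → Submodule k M) : ZMod 2 → Submodule k M := fun ε => G (ε + 1)

/-- The grading of the dual `M^* = Hom(M, k)`, where `k` is concentrated in degree `0`:
a functional has degree `ε` when it vanishes on every `M_δ` with `δ ≠ ε`. -/
def dualGrading (G : ZMod 2 → Submodule k M) (ε : ZMod 2) : Submodule k (Module.Dual k M) where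
  carrier := {f | ∀ δ, δ ≠ ε → ∀ v ∈ G δ, f v = 0}
  add_mem' := by
    intro f g hf hg δ hδ v hv
    simp [hf δ hδ v hv, hg δ hδ v hv]
  zero_mem' := by
    intro δ _ v _
    simp
  smul_mem' := by
    intro c f hf δ hδ v hv
    simp [hf δ hδ v hv]

/-- The degree `d` component of the two-sided ideal of the tensor algebra of `M` generated by the
elements `x ⊗ y - (-1)^(|x||y|) y ⊗ x`, for `x`, `y` homogeneous. -/
def symRel (G : ZMod 2 → Submodule k M) (d : ℕ) : Submodule k (⨂[k]^d M) :=
  Submodule.span k {x | ∃ (v : Fin d → M) (a b : Fin d) (α β : ZMod 2),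
    (a : ℕ) + 1 = b ∧ v a ∈ G α ∧ v b ∈ G β ∧
      x = PiTensorProduct.tprod k v -
        (koszul α β : k) • PiTensorProduct.tprod k (fun s => v (Equiv.swap a b s))}

/-- The symmetric power `S^d M`: the degree `d` component of the symmetric superalgebra of `M`. -/
def SymPow (G : ZMod 2 → Submodule k M) (d : ℕ) : Type (max u v) := (⨂[k]^d M) ⧸ symRel G d

instance (G : ZMod 2 → Submodule k M) (d : ℕ) : AddCommGroup (SymPow G d) :=
  inferInstanceAs (AddCommGroup ((⨂[k]^d M) ⧸ symRel G d))

instance (G : ZMod 2 → Submodule k M) (d : ℕ) : Module k (SymPow G d) :=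
  inferInstanceAs (Module k ((⨂[k]^d M) ⧸ symRel G d))

/-- The `d`-fold multiplication `M^{⊗ d} → S^d M` of the symmetric superalgebra. -/
def symMul (G : ZMod 2 → Submodule k M) (d : ℕ) : (⨂[k]^d M) →ₗ[k] SymPow G d :=
  (symRel G d).mkQ

/-- The map out of `S^d M` induced by a map out of `M^{⊗ d}` that kills the relations. -/
def symLift (G : ZMod 2 → Submodule k M) (d : ℕ) {N : Type*} [AddCommGroup N] [Module k N]
    (φ : (⨂[k]^d M) →ₗ[k] N) (h : symRel G d ≤ LinearMap.ker φ) : SymPow G d →ₗ[k] N :=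
  (symRel G d).liftQ φ h

theorem symLift_symMul (G : ZMod 2 → Submodule k M) (d : ℕ) {N : Type*} [AddCommGroup N]
    [Module k N] (φ : (⨂[k]^d M) →ₗ[k] N) (h : symRel G d ≤ LinearMap.ker φ) (x : ⨂[k]^d M) :
    symLift G d φ h (symMul G d x) = φ x := rfl

/-- The divided power `Γ^d M = S^d(M^*)^*`. -/
abbrev DivPow (G : ZMod 2 → Submodule k M) (d : ℕ) : Type _ :=
  Module.Dual k (SymPow (dualGrading G) d)

/-- The canonical isomorphism `M^{⊗ d} ≃ ((M^*)^{⊗ d})^*`, which sends `v_1 ⊗ ⋯ ⊗ v_d` to the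
functional `f_1 ⊗ ⋯ ⊗ f_d ↦ f_1(v_1) ⋯ f_d(v_d)`. -/
def tensorEval (k : Type u) [Field k] (M : Type v) [AddCommGroup M] [Module k M]
    [Module.Finite k M] (d : ℕ) : (⨂[k]^d M) ≃ₗ[k] Module.Dual k (⨂[k]^d (Module.Dual k M)) :=
  (PiTensorProduct.congr (fun _ : Fin d => Module.evalEquiv k M)).trans
    PiTensorProduct.dualDistribEquiv

theorem tensorEval_tprod [Module.Finite k M] (d : ℕ) (v : Fin d → M)
    (f : Fin d → Module.Dual k M) :
    tensorEval k M d (PiTensorProduct.tprod k v) (PiTensorProduct.tprod k f) =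
      ∏ s, f s (v s) := by
  simp [tensorEval, PiTensorProduct.dualDistribEquivOfBasis]

/-- The embedding `Δ : Γ^d M → M^{⊗ d}`, dual to the multiplication `(M^*)^{⊗ d} → S^d(M^*)`. -/
def divComul (G : ZMod 2 → Submodule k M) [Module.Finite k M] (d : ℕ) :
    DivPow G d →ₗ[k] ⨂[k]^d M :=
  (tensorEval k M d).symm.toLinearMap ∘ₗ (symMul (dualGrading G) d).dualMap

/-- The sign `sgn(ε, σ)`, the product of `(-1)^(ε_s ε_t)` over all `s < t` with
`σ⁻¹ s > σ⁻¹ t`. -/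
def superSign {d d' : ℕ} (ε : Fin d → ZMod 2) (σ : Fin d' ≃ Fin d) : ℤ :=
  ∏ s, ∏ t, if s < t ∧ σ.symm t < σ.symm s then koszul (ε s) (ε t) else 1

/-- The right action of the symmetric group on tensor powers of a superspace: for homogeneous
`v_1, …, v_d` of parities `ε_1, …, ε_d`,
`(v_1 ⊗ ⋯ ⊗ v_d).σ = sgn(ε, σ) v_{σ 1} ⊗ ⋯ ⊗ v_{σ d}`. -/
def superPerm (G : ZMod 2 → Submodule k M) [DirectSum.Decomposition G] {d d' : ℕ}
    (σ : Fin d' ≃ Fin d) : (⨂[k]^d M) →ₗ[k] ⨂[k]^d' M :=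
  ∑ ε : Fin d → ZMod 2, (superSign ε σ : k) •
    ((PiTensorProduct.reindex k (fun _ => M) σ.symm).toLinearMap ∘ₗ
      PiTensorProduct.map (fun s => superProj G (ε s)))

/-- The tensor power `1^{⊗ d} : (ΠM)^{⊗ d} → M^{⊗ d}` of the odd map `1 : ΠM → M`. By the rule of
signs, `(1 ⊗ ⋯ ⊗ 1)(v_1 ⊗ ⋯ ⊗ v_d)` acquires a sign `(-1)^(ε_s)` for each `s < t`, where `ε_s` is
the parity of `v_s` in `ΠM` (so that `v_s` has parity `ε_s + 1` in `M`). -/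
def shiftTensor (G : ZMod 2 → Submodule k M) [DirectSum.Decomposition G] (d : ℕ) :
    (⨂[k]^d M) →ₗ[k] ⨂[k]^d M :=
  ∑ ε : Fin d → ZMod 2, ((∏ s, ∏ t, if s < t then koszul 1 (ε s) else 1 : ℤ) : k) •
    PiTensorProduct.map (fun s => superProj G (ε s + 1))

/-- The associativity isomorphism
`⨂_{(i, j)} M ≃ ⨂_i (⨂_j M)`, `⨂_{(i, j)} v_{ij} ↦ ⨂_i (⨂_j v_{ij})`. -/
def tensorSigmaEquiv (k : Type u) [Field k] (M : Type v) [AddCommGroup M] [Module k M]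
    {q : ℕ} (n : Fin q → ℕ) :
    (⨂[k] _x : (Σ i : Fin q, Fin (n i)), M) ≃ₗ[k] ⨂[k] i : Fin q, (⨂[k]^(n i) M) :=
  (Basis.piTensorProduct (fun _ : (Σ i : Fin q, Fin (n i)) => Module.Free.chooseBasis k M)).equiv
    (Basis.piTensorProduct (fun i : Fin q =>
      Basis.piTensorProduct (fun _ : Fin (n i) => Module.Free.chooseBasis k M)))
    (Equiv.piCurry (fun _ _ => Module.Free.ChooseBasisIndex k M))

theorem tensorSigmaEquiv_tprod {q : ℕ} (n : Fin q → ℕ) (v : (Σ i : Fin q, Fin (n i)) → M) :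
    tensorSigmaEquiv k M n (PiTensorProduct.tprod k v) =
      PiTensorProduct.tprod k (fun i => PiTensorProduct.tprod k (fun j => v ⟨i, j⟩)) := by
  have key : ∀ {α β : Type v} {V W : Type (max u v)} [AddCommGroup V] [Module k V]
      [AddCommGroup W] [Module k W]
      (b : Module.Basis α k V) (b' : Module.Basis β k W) (e : α ≃ β) (x : V) (y : α),
      b'.repr (b.equiv b' e x) (e y) = b.repr x y := by
    intro α β V W _ _ _ _ b b' e x y
    have h : (b'.reindex e.symm).repr (b.equiv b' e x) = b.repr x := by
      simp only [Module.Basis.equiv, LinearEquiv.trans_apply]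
      exact LinearEquiv.apply_symm_apply _ _
    rw [← h]
    simp
  refine (Basis.piTensorProduct (fun i : Fin q =>
    Basis.piTensorProduct (fun _ : Fin (n i) => Module.Free.chooseBasis k M))).ext_elem ?_
  intro x
  obtain ⟨y, rfl⟩ := (Equiv.piCurry (fun _ _ => Module.Free.ChooseBasisIndex k M)).surjective x
  rw [tensorSigmaEquiv, key, Basis.piTensorProduct_repr_tprod_apply,
    Basis.piTensorProduct_repr_tprod_apply]
  simp only [Basis.piTensorProduct_repr_tprod_apply, Fintype.prod_sigma]
  rfl

/-- Concatenation `⨂_i M^{⊗ n_i} ≃ M^{⊗ (n_1 + ⋯ + n_q)}`. -/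
def concat (k : Type u) [Field k] (M : Type v) [AddCommGroup M] [Module k M]
    {q : ℕ} (n : Fin q → ℕ) :
    (⨂[k] i : Fin q, (⨂[k]^(n i) M)) ≃ₗ[k] ⨂[k]^(∑ i, n i) M :=
  (tensorSigmaEquiv k M n).symm.trans
    (PiTensorProduct.reindex k (fun _ => M) finSigmaFinEquiv)

end Powers

section DividedBasis

variable {ι : Type} [LinearOrder ι]

/-- A word is restricted when no odd letter is repeated. -/
def IsRestricted (p : ι → ZMod 2) {d : ℕ} (w : Fin d → ι) : Prop :=
  ∀ s t, w s = w t → p (w s) = 1 → s = t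

/-- The sign of the permutation that sorts a word into nondecreasing order: the product of
`(-1)^(|w_s||w_t|)` over all `s < t` with `w_s > w_t`. -/
def wordSign (p : ι → ZMod 2) {d : ℕ} (w : Fin d → ι) : ℤ :=
  ∏ s, ∏ t, if s < t ∧ w t < w s then koszul (p (w s)) (p (w t)) else 1

open Classical in
/-- The value at the monomial `Ž_{j_1} ⋯ Ž_{j_d}` of the functional dual to `Ž_{i_1} ⋯ Ž_{i_d}`:
it is the sign relating the two monomials if `j` is a rearrangement of `i`, and `0` otherwise. -/
def dualCoeff (p : ι → ZMod 2) {d : ℕ} (i j : Fin d → ι) : ℤ :=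
  if IsRestricted p i ∧ ∃ τ : Equiv.Perm (Fin d), ∀ s, j s = i (τ s) then
    wordSign p i * wordSign p j else 0

theorem koszul_mul_self (a b : ZMod 2) : koszul a b * koszul a b = 1 := by
  unfold koszul
  split_ifs <;> norm_num

theorem wordSign_mul_self (p : ι → ZMod 2) {d : ℕ} (w : Fin d → ι) :
    wordSign p w * wordSign p w = 1 := by
  unfold wordSign
  rw [← Finset.prod_mul_distrib]
  refine Finset.prod_eq_one fun s _ => ?_
  rw [← Finset.prod_mul_distrib]
  refine Finset.prod_eq_one fun t _ => ?_
  split_ifs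
  · exact koszul_mul_self _ _
  · norm_num

theorem wordSign_swap (p : ι → ZMod 2) {d : ℕ} (w : Fin d → ι) (a b : Fin d)
    (hab : (a : ℕ) + 1 = b) (hw : ¬ (w a = w b ∧ p (w a) = 1)) :
    wordSign p (fun s => w (Equiv.swap a b s)) = koszul (p (w a)) (p (w b)) * wordSign p w := by
  have hlt : a < b := by rw [Fin.lt_def]; omega
  have hne : a ≠ b := ne_of_lt hlt
  have hsymm : ∀ x y, koszul x y = koszul y x := by
    intro x y; unfold koszul; simp only [and_comm]
  have key : wordSign p (fun s => w (Equiv.swap a b s)) * wordSign p w =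
      koszul (p (w a)) (p (w b)) := by
    have h1 : wordSign p (fun s => w (Equiv.swap a b s)) =
        ∏ x : Fin d × Fin d, if Equiv.swap a b x.1 < Equiv.swap a b x.2 ∧ w x.2 < w x.1 then
          koszul (p (w x.1)) (p (w x.2)) else 1 := by
      unfold wordSign
      rw [← Fintype.prod_prod_type', ← Equiv.prod_comp
        (Equiv.prodCongr (Equiv.swap a b) (Equiv.swap a b))]
      refine Finset.prod_congr rfl fun x _ => ?_
      simp [Equiv.swap_apply_self]
    have h2 : wordSign p w = ∏ x : Fin d × Fin d, if x.1 < x.2 ∧ w x.2 < w x.1 then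
          koszul (p (w x.1)) (p (w x.2)) else 1 := by
      unfold wordSign
      rw [← Fintype.prod_prod_type']
    rw [h1, h2, ← Finset.prod_mul_distrib]
    rw [Finset.prod_eq_mul (a, b) (b, a)]
    · simp only [Equiv.swap_apply_left, Equiv.swap_apply_right, hlt, not_lt.2 hlt.le, true_and,
        false_and, if_false, one_mul, mul_one]
      rcases lt_trichotomy (w a) (w b) with h | h | h
      · simp [h, not_lt.2 h.le, hsymm]
      · have hp : p (w a) ≠ 1 := fun hp => hw ⟨h, hp⟩
        rw [h] at hp
        simp [h, koszul, hp]
      · simp [h, not_lt.2 h.le]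
    · simp [hne]
    · rintro ⟨s, t⟩ _ ⟨hst, hts⟩
      have hiff : (Equiv.swap a b s < Equiv.swap a b t) ↔ s < t := by
        simp only [ne_eq, Prod.mk.injEq, not_and] at hst hts
        simp only [Equiv.swap_apply_def, Fin.lt_def]
        simp only [Fin.ext_iff] at *
        split_ifs <;> omega
      simp only [hiff]
      split_ifs
      · exact koszul_mul_self _ _
      · norm_num
    · simp
    · simp
  calc _ = wordSign p (fun s => w (Equiv.swap a b s)) * (wordSign p w * wordSign p w) := by
        rw [wordSign_mul_self, mul_one]
    _ = _ := by rw [← mul_assoc, key]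

theorem dualCoeff_swap (p : ι → ZMod 2) {d : ℕ} (i j : Fin d → ι) (a b : Fin d)
    (hab : (a : ℕ) + 1 = b) :
    dualCoeff p i (fun s => j (Equiv.swap a b s)) =
      koszul (p (j a)) (p (j b)) * dualCoeff p i j := by
  have hiff : (∃ τ : Equiv.Perm (Fin d), ∀ s, j (Equiv.swap a b s) = i (τ s)) ↔
      ∃ τ : Equiv.Perm (Fin d), ∀ s, j s = i (τ s) := by
    constructor
    · rintro ⟨τ, h⟩
      refine ⟨(Equiv.swap a b).trans τ, fun s => ?_⟩
      have := h (Equiv.swap a b s)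
      rwa [Equiv.swap_apply_self] at this
    · rintro ⟨τ, h⟩
      exact ⟨(Equiv.swap a b).trans τ, fun s => h _⟩
  rw [dualCoeff, dualCoeff]
  by_cases h : IsRestricted p i ∧ ∃ τ : Equiv.Perm (Fin d), ∀ s, j s = i (τ s)
  · obtain ⟨hi, τ, hτ⟩ := h
    rw [if_pos ⟨hi, hiff.2 ⟨τ, hτ⟩⟩, if_pos ⟨hi, τ, hτ⟩, wordSign_swap p j a b hab]
    · ring
    · rintro ⟨h1, h2⟩
      rw [hτ a, hτ b] at h1
      rw [hτ a] at h2
      have := τ.injective (hi _ _ h1 h2)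
      rw [this] at hab
      omega
  · rw [if_neg h, if_neg (fun h' => h ⟨h'.1, hiff.1 h'.2⟩), mul_zero]

variable [Fintype ι] {k : Type u} [Field k] {M : Type v} [AddCommGroup M] [Module k M]

/-- The functional on `(M^*)^{⊗ d}` with value `dualCoeff p i j` at `Ž_{j_1} ⊗ ⋯ ⊗ Ž_{j_d}`. -/
def dualFunctional (b : Module.Basis ι k M) (p : ι → ZMod 2) {d : ℕ} (i : Fin d → ι) :
    (⨂[k]^d (Module.Dual k M)) →ₗ[k] k :=
  ∑ j : Fin d → ι, (dualCoeff p i j : k) • PiTensorProduct.lift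
    ((MultilinearMap.mkPiAlgebra k (Fin d) k).compLinearMap
      (fun s => Module.Dual.eval k M (b (j s))))

theorem dualFunctional_tprod (b : Module.Basis ι k M) (p : ι → ZMod 2) {d : ℕ} (i : Fin d → ι)
    (f : Fin d → Module.Dual k M) :
    dualFunctional b p i (PiTensorProduct.tprod k f) =
      ∑ j : Fin d → ι, (dualCoeff p i j : k) * ∏ s, f s (b (j s)) := by
  simp [dualFunctional]

theorem dualFunctional_symRel (G : ZMod 2 → Submodule k M) (b : Module.Basis ι k M)
    (p : ι → ZMod 2) (hb : ∀ j, b j ∈ G (p j)) {d : ℕ} (i : Fin d → ι) :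
    symRel (dualGrading G) d ≤ LinearMap.ker (dualFunctional b p i) := by
  refine Submodule.span_le.2 ?_
  rintro x ⟨f, s, t, α, β, hst, hs, ht, rfl⟩
  have hs' : ∀ δ, δ ≠ α → ∀ v ∈ G δ, f s v = 0 := hs
  have ht' : ∀ δ, δ ≠ β → ∀ v ∈ G δ, f t v = 0 := ht
  simp only [SetLike.mem_coe, LinearMap.mem_ker, map_sub, map_smul, dualFunctional_tprod]
  have h1 : ∑ j : Fin d → ι, (dualCoeff p i j : k) * ∏ r, f (Equiv.swap s t r) (b (j r)) =
      ∑ j : Fin d → ι, (dualCoeff p i (fun r => j (Equiv.swap s t r)) : k) *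
        ∏ r, f r (b (j r)) := by
    rw [← Equiv.sum_comp (Equiv.arrowCongr (Equiv.swap s t) (Equiv.refl ι))]
    refine Finset.sum_congr rfl fun j _ => ?_
    congr 1
    rw [← Equiv.prod_comp (Equiv.swap s t)]
    simp
  rw [h1, sub_eq_zero, smul_eq_mul, Finset.mul_sum]
  refine Finset.sum_congr rfl fun j _ => ?_
  by_cases hα : p (j s) = α
  · by_cases hβ : p (j t) = β
    · rw [dualCoeff_swap p i j s t hst, hα, hβ, ← mul_assoc, ← Int.cast_mul, ← mul_assoc,
        koszul_mul_self, one_mul]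
    · rw [Finset.prod_eq_zero (Finset.mem_univ t) (ht' _ hβ _ (hb _))]
      simp
  · rw [Finset.prod_eq_zero (Finset.mem_univ s) (hs' _ hα _ (hb _))]
    simp

/-- The divided power monomial `Z^{(i)} ∈ Γ^d M = S^d(M^*)^*`, for a homogeneous basis `Z` of `M`
with dual basis `Ž`: the functional dual to the monomial `Ž_{i_1} ⋯ Ž_{i_d}`. -/
def divMonomial (G : ZMod 2 → Submodule k M) (b : Module.Basis ι k M) (p : ι → ZMod 2)
    (hb : ∀ j, b j ∈ G (p j)) {d : ℕ} (i : Fin d → ι) : DivPow G d :=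
  symLift (dualGrading G) d (dualFunctional b p i) (dualFunctional_symRel G b p hb i)

theorem divMonomial_monomial (G : ZMod 2 → Submodule k M) (b : Module.Basis ι k M)
    (p : ι → ZMod 2) (hb : ∀ j, b j ∈ G (p j)) {d : ℕ} (i j : Fin d → ι) :
    divMonomial G b p hb i
      (symMul (dualGrading G) d (PiTensorProduct.tprod k (fun s => b.coord (j s)))) =
      dualCoeff p i j := by
  classical
  rw [divMonomial, symLift_symMul, dualFunctional_tprod, Finset.sum_eq_single j]
  · simp
  · intro l _ hl
    obtain ⟨s, hs⟩ := Function.ne_iff.1 hl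
    rw [Finset.prod_eq_zero (Finset.mem_univ s)]
    · simp
    · simp [hs]
  · simp

/-- Among the basis monomials of `S^d(M^*)` (those of nondecreasing restricted words),
`Z^{(i)}` is `1` at the monomial of `i` and `0` at all others. -/
theorem divMonomial_dual (G : ZMod 2 → Submodule k M) (b : Module.Basis ι k M)
    (p : ι → ZMod 2) (hb : ∀ j, b j ∈ G (p j)) {d : ℕ} (i j : Fin d → ι)
    (hi : Monotone i) (hj : Monotone j) (hri : IsRestricted p i) :
    divMonomial G b p hb i
      (symMul (dualGrading G) d (PiTensorProduct.tprod k (fun s => b.coord (j s)))) =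
      (open Classical in if j = i then 1 else 0) := by
  rw [divMonomial_monomial]
  split_ifs with h
  · subst h
    have : ∃ τ : Equiv.Perm (Fin d), ∀ s, j s = j (τ s) := ⟨Equiv.refl _, fun _ => rfl⟩
    simp [dualCoeff, hri, this, wordSign_mul_self]
  · unfold dualCoeff
    rw [if_neg]
    · simp
    · rintro ⟨-, τ, hτ⟩
      refine h ?_
      have h1 : j = i ∘ τ := funext hτ
      have := Tuple.unique_monotone (f := i) (σ := τ) (τ := Equiv.refl _) (h1 ▸ hj) hi
      rw [h1]
      exact this

end DividedBasis

theorem superProj_of_mem {k : Type u} [Field k] {M : Type v} [AddCommGroup M] [Module k M]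
    (G : ZMod 2 → Submodule k M) [DirectSum.Decomposition G] {δ : ZMod 2} (ε : ZMod 2) {v : M}
    (hv : v ∈ G δ) : superProj G ε v = if ε = δ then v else 0 := by
  have : superProj G ε v = (DirectSum.decompose G v ε : M) := rfl
  rw [this]
  split_ifs with h
  · subst h; exact DirectSum.decompose_of_mem_same G hv
  · exact DirectSum.decompose_of_mem_ne G hv (Ne.symm h)

theorem sum_proj_tprod {k : Type u} [Field k] {M : Type v} [AddCommGroup M] [Module k M]
    (G : ZMod 2 → Submodule k M) [DirectSum.Decomposition G] {d : ℕ} (v : Fin d → M)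
    (ε : Fin d → ZMod 2) (hv : ∀ s, v s ∈ G (ε s)) (η : Fin d → ZMod 2) :
    PiTensorProduct.tprod k (fun s => superProj G (η s) (v s)) =
      if η = ε then PiTensorProduct.tprod k v else 0 := by
  split_ifs with h
  · subst h
    simp [superProj_of_mem G _ (hv _)]
  · obtain ⟨s, hs⟩ := Function.ne_iff.1 h
    refine (PiTensorProduct.tprod k).map_coord_zero s ?_
    rw [superProj_of_mem G _ (hv s), if_neg hs]

theorem superPerm_tprod {k : Type u} [Field k] {M : Type v} [AddCommGroup M] [Module k M]
    (G : ZMod 2 → Submodule k M) [DirectSum.Decomposition G] {d d' : ℕ} (σ : Fin d' ≃ Fin d)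
    (v : Fin d → M) (ε : Fin d → ZMod 2) (hv : ∀ s, v s ∈ G (ε s)) :
    superPerm G σ (PiTensorProduct.tprod k v) =
      (superSign ε σ : k) • PiTensorProduct.tprod k (fun s => v (σ s)) := by
  simp only [superPerm, LinearMap.sum_apply, LinearMap.smul_apply, LinearMap.comp_apply,
    PiTensorProduct.map_tprod, sum_proj_tprod G v ε hv]
  rw [Finset.sum_eq_single ε]
  · rw [if_pos rfl]
    simp [PiTensorProduct.reindex_tprod]
  · intro η _ hη
    simp [hη]
  · simp

theorem shiftTensor_tprod {k : Type u} [Field k] {M : Type v} [AddCommGroup M] [Module k M]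
    (G : ZMod 2 → Submodule k M) [DirectSum.Decomposition G] {d : ℕ}
    (v : Fin d → M) (ε : Fin d → ZMod 2) (hv : ∀ s, v s ∈ parityShift G (ε s)) :
    shiftTensor G d (PiTensorProduct.tprod k v) =
      ((∏ s, ∏ t, if s < t then koszul 1 (ε s) else 1 : ℤ) : k) • PiTensorProduct.tprod k v := by
  simp only [shiftTensor, LinearMap.sum_apply, LinearMap.smul_apply,
    PiTensorProduct.map_tprod]
  rw [Finset.sum_eq_single ε]
  · rw [sum_proj_tprod G v (fun s => ε s + 1) hv (fun s => ε s + 1), if_pos rfl]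
  · intro η _ hη
    rw [sum_proj_tprod G v (fun s => ε s + 1) hv (fun s => η s + 1), if_neg, smul_zero]
    intro h
    exact hη (funext fun s => by simpa using congrFun h s)
  · simp

section Diagrams

/-- The skew diagram of `lam/mu`, with rows and columns numbered from `0`. -/
abbrev Box (lam mu : YoungDiagram) : Type := {c : ℕ × ℕ // c ∈ lam ∧ c ∉ mu}

/-- The length `lam_i - mu_i` of the `i`-th row of `lam/mu`. -/
abbrev skewRow (lam mu : YoungDiagram) (i : Fin (lam.colLen 0)) : ℕ := lam.rowLen i - mu.rowLen i

/-- The length `lam'_j - mu'_j` of the `j`-th column of `lam/mu`. -/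
abbrev skewCol (lam mu : YoungDiagram) (j : Fin (lam.rowLen 0)) : ℕ := lam.colLen j - mu.colLen j

/-- The boxes of `lam/mu`, listed by row and by position in the row. -/
def rowBox (lam mu : YoungDiagram) :
    (Σ i : Fin (lam.colLen 0), Fin (skewRow lam mu i)) ≃ Box lam mu where
  toFun x := ⟨(x.1, mu.rowLen x.1 + x.2), by
    have := x.2.2
    simp only [skewRow] at this
    simp only [YoungDiagram.mem_iff_lt_rowLen]
    omega⟩
  invFun c := ⟨⟨c.1.1, YoungDiagram.mem_iff_lt_colLen.1
      (lam.up_left_mem le_rfl (Nat.zero_le _) c.2.1)⟩, ⟨c.1.2 - mu.rowLen c.1.1, by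
    obtain ⟨⟨a, b⟩, h1, h2⟩ := c
    rw [YoungDiagram.mem_iff_lt_rowLen] at h1 h2
    simp only [skewRow]
    omega⟩⟩
  left_inv x := by
    obtain ⟨i, r⟩ := x
    simp
  right_inv c := by
    obtain ⟨⟨a, b⟩, h1, h2⟩ := c
    rw [YoungDiagram.mem_iff_lt_rowLen] at h1 h2
    ext
    · simp
    · simp only
      omega

/-- The boxes of `lam/mu`, listed by column and by position in the column. -/
def colBox (lam mu : YoungDiagram) :
    (Σ j : Fin (lam.rowLen 0), Fin (skewCol lam mu j)) ≃ Box lam mu where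
  toFun x := ⟨(mu.colLen x.1 + x.2, x.1), by
    have := x.2.2
    simp only [skewCol] at this
    simp only [YoungDiagram.mem_iff_lt_colLen]
    omega⟩
  invFun c := ⟨⟨c.1.2, YoungDiagram.mem_iff_lt_rowLen.1
      (lam.up_left_mem (Nat.zero_le _) le_rfl c.2.1)⟩, ⟨c.1.1 - mu.colLen c.1.2, by
    obtain ⟨⟨a, b⟩, h1, h2⟩ := c
    rw [YoungDiagram.mem_iff_lt_colLen] at h1 h2
    simp only [skewCol]
    omega⟩⟩
  left_inv x := by
    obtain ⟨i, r⟩ := x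
    simp
  right_inv c := by
    obtain ⟨⟨a, b⟩, h1, h2⟩ := c
    rw [YoungDiagram.mem_iff_lt_colLen] at h1 h2
    ext
    · simp only
      omega
    · simp

/-- The number of a box of `lam/mu` in the reading along the rows, top to bottom. -/
def rowNumber (lam mu : YoungDiagram) : Box lam mu ≃ Fin (∑ i, skewRow lam mu i) :=
  (rowBox lam mu).symm.trans finSigmaFinEquiv

/-- The number of a box of `lam/mu` in the reading down the columns, left to right; equivalently,
the number of the corresponding box of `lam'/mu'` in the reading along the rows. -/
def colNumber (lam mu : YoungDiagram) : Box lam mu ≃ Fin (∑ j, skewCol lam mu j) :=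
  (colBox lam mu).symm.trans finSigmaFinEquiv

/-- The permutation `σ_{lam'/mu'}` of `{1, …, d}`: it sends the number of a box in the reading of
`lam'/mu'` along the rows to its number in the reading of `lam'/mu'` down the columns, that is, the
column number in `lam/mu` to the row number in `lam/mu`. -/
def sigmaConj (lam mu : YoungDiagram) :
    Fin (∑ j, skewCol lam mu j) ≃ Fin (∑ i, skewRow lam mu i) :=
  (colNumber lam mu).symm.trans (rowNumber lam mu)

/-- Tableaux of shape `lam/mu` with values in `ι`. -/
abbrev Tableau (lam mu : YoungDiagram) (ι : Type) : Type := Box lam mu → ι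

variable {lam mu : YoungDiagram} {ι : Type} [LinearOrder ι]

/-- Rows are nondecreasing and repeated entries in a row are odd. -/
def IsRowCostandard (p : ι → ZMod 2) (t : Tableau lam mu ι) : Prop :=
  ∀ c c' : Box lam mu, c.1.1 = c'.1.1 → c.1.2 < c'.1.2 →
    t c ≤ t c' ∧ (t c = t c' → p (t c) = 1)

/-- Columns are nondecreasing and repeated entries in a column are even. -/
def IsColCostandard (p : ι → ZMod 2) (t : Tableau lam mu ι) : Prop :=
  ∀ c c' : Box lam mu, c.1.2 = c'.1.2 → c.1.1 < c'.1.1 →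
    t c ≤ t c' ∧ (t c = t c' → p (t c) = 0)

/-- Costandard tableaux. -/
def IsCostandard (p : ι → ZMod 2) (t : Tableau lam mu ι) : Prop :=
  IsRowCostandard p t ∧ IsColCostandard p t

/-- The word formed by the entries of the `i`-th row of a tableau, read from left to right. -/
def rowWord (t : Tableau lam mu ι) (i : Fin (lam.colLen 0)) : Fin (skewRow lam mu i) → ι :=
  fun r => t (rowBox lam mu ⟨i, r⟩)

end Diagrams

section Superfunctors

variable (k : Type u) [Field k]

/-- Finite dimensional vector superspaces. -/
structure Superspace where
  /-- The underlying vector space. -/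
  carrier : Type v
  [addCommGroup : AddCommGroup carrier]
  [module : Module k carrier]
  [finite : Module.Finite k carrier]
  /-- The homogeneous components. -/
  grading : ZMod 2 → Submodule k carrier
  [decomposition : DirectSum.Decomposition grading]

attribute [instance] Superspace.addCommGroup Superspace.module Superspace.finite
  Superspace.decomposition

/-- The Clifford superalgebra `C_1`, with one odd generator `c` such that `c ^ 2 = 1`; its
`ZMod 2`-grading is `CliffordAlgebra.evenOdd`. -/
abbrev CliffordOne : Type u := CliffordAlgebra (QuadraticMap.sq : QuadraticForm k k)

theorem cliffordOne_gen_sq :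
    CliffordAlgebra.ι (QuadraticMap.sq : QuadraticForm k k) 1 *
      CliffordAlgebra.ι (QuadraticMap.sq : QuadraticForm k k) 1 = 1 := by
  simp [CliffordAlgebra.ι_sq_scalar]

/-- Finite dimensional right `C_1`-supermodules. -/
structure CliffordSupermodule extends Superspace.{u, v} k where
  [rightModule : Module (CliffordOne k)ᵐᵒᵖ carrier]
  [scalarTower : IsScalarTower k (CliffordOne k)ᵐᵒᵖ carrier]
  graded : ∀ (ε δ : ZMod 2), ∀ a ∈ CliffordAlgebra.evenOdd (QuadraticMap.sq : QuadraticForm k k) ε,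
    ∀ v ∈ grading δ, MulOpposite.op a • v ∈ grading (ε + δ)

variable {k}

/-- The functor `F_C` that forgets the action of `C_1`. -/
abbrev CliffordSupermodule.forget (V : CliffordSupermodule.{u, v} k) : Superspace.{u, v} k :=
  V.toSuperspace

variable (M : Superspace.{u, v} k) (lam mu : YoungDiagram)

/-- `Γ_Π^{lam/mu}(M) = ⨂_i Γ^{lam_i - mu_i}(ΠM)`. -/
abbrev GammaPi : Type (max u v) :=
  ⨂[k] i : Fin (lam.colLen 0), DivPow (parityShift M.grading) (skewRow lam mu i)

/-- `S^{lam'/mu'}(M) = ⨂_j S^{lam'_j - mu'_j}(M)`. -/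
abbrev SymConj : Type (max u v) :=
  ⨂[k] j : Fin (lam.rowLen 0), SymPow M.grading (skewCol lam mu j)

/-- `Δ_Π : Γ_Π^{lam/mu}(M) → (ΠM)^{⊗ d} → M^{⊗ d}`, the tensor product of the embeddings `Δ`
followed by `1^{⊗ d}`. -/
def deltaPi : GammaPi M lam mu →ₗ[k] ⨂[k]^(∑ i, skewRow lam mu i) M.carrier :=
  shiftTensor M.grading _ ∘ₗ (concat k M.carrier (skewRow lam mu)).toLinearMap ∘ₗ
    PiTensorProduct.map (fun i => divComul (parityShift M.grading) (skewRow lam mu i))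

/-- `m : M^{⊗ d} → S^{lam'/mu'}(M)`, the tensor product of the multiplication maps. -/
def mulConj : (⨂[k]^(∑ j, skewCol lam mu j) M.carrier) →ₗ[k] SymConj M lam mu :=
  PiTensorProduct.map (fun j => symMul M.grading (skewCol lam mu j)) ∘ₗ
    (concat k M.carrier (skewCol lam mu)).symm.toLinearMap

/-- The component at `M` of `θ̂_{lam'/mu'} : Γ_Π^{lam/mu} → S^{lam'/mu'}`. -/
def thetaConj : GammaPi M lam mu →ₗ[k] SymConj M lam mu :=
  mulConj M lam mu ∘ₗ superPerm M.grading (sigmaConj lam mu) ∘ₗ deltaPi M lam mu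

/-- The Schur superfunctor of type I of shape `lam'/mu'` at `M`: the image of `θ̂_{lam'/mu'}(M)`. -/
def schurConj : Submodule k (SymConj M lam mu) := LinearMap.range (thetaConj M lam mu)

/-- The component at `V` of `θ̂^II_{lam'/mu'}`, the composition of `θ̂_{lam'/mu'}` with `F_C`. -/
def thetaConjII (V : CliffordSupermodule.{u, v} k) :
    GammaPi V.forget lam mu →ₗ[k] SymConj V.forget lam mu :=
  thetaConj V.forget lam mu

/-- The Schur superfunctor of type II of shape `lam'/mu'` at `V`: the restriction along `F_C` of the
Schur superfunctor of type I. -/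
def schurConjII (V : CliffordSupermodule.{u, v} k) : Submodule k (SymConj V.forget lam mu) :=
  schurConj V.forget lam mu

variable {M lam mu}

theorem mem_parityShift {ι : Type} (Z : Module.Basis ι k M.carrier) (p : ι → ZMod 2)
    (hZ : ∀ i, Z i ∈ M.grading (p i)) (i : ι) :
    Z i ∈ parityShift M.grading (p i + 1) := by
  have : p i + 1 + 1 = p i := by
    rw [add_assoc]
    exact add_zero (p i)
  rw [parityShift, this]
  exact hZ i

variable {ι : Type} [LinearOrder ι] [Fintype ι]

/-- The element `Z_Π^{(t)} = ⨂_i (ΠZ)^{(t^i)}` of `Γ_Π^{lam/mu}(M)`, where `Z` is a homogeneous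
basis of `M` with parities `p`, so that `ΠZ` is a homogeneous basis of `ΠM` with parities
`p + 1`. -/
def gammaPiMonomial (Z : Module.Basis ι k M.carrier) (p : ι → ZMod 2)
    (hZ : ∀ i, Z i ∈ M.grading (p i)) (t : Tableau lam mu ι) : GammaPi M lam mu :=
  PiTensorProduct.tprod k (fun i =>
    divMonomial (parityShift M.grading) Z (fun j => p j + 1) (mem_parityShift Z p hZ)
      (rowWord t i))

end Superfunctors

end SuperSchur
end

/-! By definition the type II map at `V` is the type I map at the underlying superspace, so what has
to be proved is the type I statement for an arbitrary ordered homogeneous basis. Because 2 is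
nonzero in `k`, the symmetric and divided powers have bases of monomials in sorted restricted words.
In these bases the matrix of `thetaConj` is the image in `k` of an integer matrix, `boxCoeff`. Its
entry at `(x, s)` is a signed sum over the fillings `y` that rearrange `x` within rows and `s`
within columns. The theorem rests on two properties of this matrix.

Unitriangularity (`boxCoeff_triangular`, `boxCoeff_self_mul_self`): restricted to costandard
tableaux, the diagonal entries are 1 or -1, and a nonzero off-diagonal entry forces a strict drop of
the column weight. The reason is the rearrangement inequality: a tableau with sorted rows has the
largest column weight among its row rearrangements, while column permutations do not change this
weight. Linear independence over every `k` follows (`linearIndependent_thetaConj`).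

Straightening (`exists_boxCoeff_eq_sum`): every row of the matrix is an integral combination of the
rows of costandard tableaux. Over the rationals the matrix agrees, up to nonzero factors (signs and
orders of stabilizers), with `symCoeff`. This is a signed sum over the row group followed by the
column group, and it satisfies Garnir relations (`sum_symCoeff_eq_zero`). Applied to a violation of
the column condition, a Garnir relation expresses the filling through fillings of larger row weight,
at the price of dividing by a positive integer (`symVec_mem_span`). The rational coefficients so
obtained solve a system with the unitriangular matrix above and integral right hand sides, so they
are integers (`mem_of_triangular`). The expansion therefore makes sense over `k` in any
characteristic other than 2, and the images of costandard monomials span. -/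

namespace SuperSchur

/-! ### Signs of reorderings as products over pairs -/

section PairProducts

variable {β : Type*} [Fintype β]

theorem koszul_comm (a b : ZMod 2) : koszul a b = koszul b a := by
  unfold koszul; simp only [and_comm]

theorem koszul_zero_left (b : ZMod 2) : koszul 0 b = 1 := by
  simp [koszul]

theorem koszul_zero_right (b : ZMod 2) : koszul b 0 = 1 := by
  simp [koszul]

theorem koszul_one_one : koszul 1 1 = -1 := by
  simp [koszul]

/-- The contribution of one pair to the comparison of signs in `M` and in `ΠM`; see
`permSign_mul_permSign_one`. -/
theorem koszul_shift (a b : ZMod 2) :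
    koszul a b * koszul 1 1 = koszul (a + 1) (b + 1) * (koszul 1 (a + 1) * koszul 1 (b + 1)) := by
  revert a b
  decide

/-- A double product over ordered pairs only depends on its diagonal and on the products of the
two factors belonging to each unordered pair. -/
theorem prod_pairs_congr (F G : β → β → ℤ) (hd : ∀ b, F b b = G b b)
    (h : ∀ b c, b ≠ c → F b c * F c b = G b c * G c b) :
    ∏ b, ∏ c, F b c = ∏ b, ∏ c, G b c := by
  classical
  let r := Fintype.equivFin β
  have key : ∀ H : β → β → ℤ, ∏ b, ∏ c, H b c =
      ∏ b, ∏ c, if r b < r c then H b c * H c b else if b = c then H b b else 1 := by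
    intro H
    have h1 : ∀ b c, H b c = (if r b < r c then H b c else 1) *
        ((if r c < r b then H b c else 1) * (if b = c then H b c else 1)) := by
      intro b c
      rcases lt_trichotomy (r b) (r c) with hlt | heq | hgt
      · have : b ≠ c := fun hbc => by simp [hbc] at hlt
        simp [hlt, hlt.not_gt, this]
      · have : b = c := r.injective heq
        simp [this]
      · have : b ≠ c := fun hbc => by simp [hbc] at hgt
        simp [hgt, hgt.not_gt, this]
    have h2 : ∀ b c, (if r b < r c then H b c * H c b else if b = c then H b b else 1) =
        (if r b < r c then H b c else 1) *
        ((if r b < r c then H c b else 1) * (if b = c then H b c else 1)) := by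
      intro b c
      rcases lt_trichotomy (r b) (r c) with hlt | heq | hgt
      · have : b ≠ c := fun hbc => by simp [hbc] at hlt
        simp [hlt, this]
      · have : b = c := r.injective heq
        simp [this]
      · have : b ≠ c := fun hbc => by simp [hbc] at hgt
        simp [hgt.not_gt, this]
    rw [Finset.prod_congr rfl fun b _ => Finset.prod_congr rfl fun c _ => h1 b c,
      Finset.prod_congr rfl fun b _ => Finset.prod_congr rfl fun c _ => h2 b c]
    simp only [Finset.prod_mul_distrib]
    congr 2
    exact Finset.prod_comm
  rw [key F, key G]
  refine Finset.prod_congr rfl fun b _ => Finset.prod_congr rfl fun c _ => ?_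
  split_ifs with h1 h2
  · exact h b c fun hbc => by simp [hbc] at h1
  · exact hd b
  · rfl

/-- The sign of passing from the arrangement of homogeneous elements in the order of the ranks `f`
to their arrangement in the order of the ranks `g`. -/
def relSign (f g : β → ℕ) (ε : β → ZMod 2) : ℤ :=
  ∏ b, ∏ c, if f b < f c ∧ g c < g b then koszul (ε b) (ε c) else 1

theorem relSign_mul_self (f g : β → ℕ) (ε : β → ZMod 2) :
    relSign f g ε * relSign f g ε = 1 := by
  unfold relSign
  simp only [← Finset.prod_mul_distrib]
  refine Finset.prod_eq_one fun b _ => Finset.prod_eq_one fun c _ => ?_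
  split_ifs
  · exact koszul_mul_self _ _
  · norm_num

/-- A pair contributes exactly when the two rankings order it oppositely, and for three rankings the
number of such disagreements on a pair is even. -/
theorem relSign_mul {f g h : β → ℕ} (hf : f.Injective) (hg : g.Injective) (hh : h.Injective)
    (ε : β → ZMod 2) : relSign f g ε * relSign g h ε = relSign f h ε := by
  unfold relSign
  simp only [← Finset.prod_mul_distrib]
  refine prod_pairs_congr _ _ (fun b => by simp) fun b c hbc => ?_
  have hK := koszul_mul_self (ε b) (ε c)
  rw [koszul_comm (ε c) (ε b)]
  rcases lt_or_gt_of_ne (hf.ne hbc) with h1 | h1 <;> rcases lt_or_gt_of_ne (hg.ne hbc) with h2 | h2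
    <;> rcases lt_or_gt_of_ne (hh.ne hbc) with h3 | h3 <;>
    simp [h1, h2, h3, h1.not_gt, h2.not_gt, h3.not_gt, hK]

theorem relSign_self (f : β → ℕ) (ε : β → ZMod 2) : relSign f f ε = 1 := by
  unfold relSign
  refine Finset.prod_eq_one fun b _ => Finset.prod_eq_one fun c _ => ?_
  rw [if_neg]
  rintro ⟨h1, h2⟩
  exact lt_asymm h1 h2

theorem relSign_comm {f g : β → ℕ} (hf : f.Injective) (hg : g.Injective) (ε : β → ZMod 2) :
    relSign g f ε = relSign f g ε := by
  have h := relSign_mul hf hg hf ε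
  rw [relSign_self] at h
  calc relSign g f ε = (relSign f g ε * relSign f g ε) * relSign g f ε := by
        rw [relSign_mul_self, one_mul]
    _ = _ := by rw [mul_assoc, h, mul_one]

theorem relSign_comp {γ : Type*} [Fintype γ] (w : γ ≃ β) (f g : β → ℕ) (ε : β → ZMod 2) :
    relSign (f ∘ w) (g ∘ w) (ε ∘ w) = relSign f g ε := by
  unfold relSign
  rw [← Equiv.prod_comp w]
  refine Finset.prod_congr rfl fun b _ => ?_
  rw [← Equiv.prod_comp w]
  rfl

/-- The sign by which the permutation `w` acts on a tensor with factors of parities `ε`. -/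
def permSign (f : β → ℕ) (ε : β → ZMod 2) (w : Equiv.Perm β) : ℤ :=
  relSign f (f ∘ w.symm) ε

theorem permSign_mul_self (f : β → ℕ) (ε : β → ZMod 2) (w : Equiv.Perm β) :
    permSign f ε w * permSign f ε w = 1 := relSign_mul_self _ _ _

/-- Acting by `w` rearranges the factors, so `w'` then meets the parities `ε ∘ w`: the sign is a
crossed homomorphism. For constant `ε` it becomes a character. -/
theorem permSign_mul {f : β → ℕ} (hf : f.Injective) (ε : β → ZMod 2) (w w' : Equiv.Perm β) :
    permSign f ε (w * w') = permSign f ε w * permSign f (ε ∘ w) w' := by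
  unfold permSign
  have h := relSign_comp w (f ∘ w.symm) ((f ∘ w'.symm) ∘ w.symm) ε
  have e1 : (f ∘ w.symm) ∘ w = f := by ext b; simp
  have e2 : ((f ∘ w'.symm) ∘ w.symm) ∘ w = f ∘ w'.symm := by ext b; simp
  rw [e1, e2] at h
  rw [h, relSign_mul hf (hf.comp w.symm.injective)
    ((hf.comp w'.symm.injective).comp w.symm.injective)]
  rfl

/-- A permutation that only moves even elements acts without sign. -/
theorem permSign_eq_one (f : β → ℕ) (ε : β → ZMod 2) (w : Equiv.Perm β)
    (h : ∀ b, w b ≠ b → ε b = 0) : permSign f ε w = 1 := by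
  have h' : ∀ b, w.symm b ≠ b → ε b = 0 := fun b hb => h b fun hw => hb (by
    rw [Equiv.symm_apply_eq]; exact hw.symm)
  unfold permSign relSign
  refine Finset.prod_eq_one fun b _ => Finset.prod_eq_one fun c _ => ?_
  split_ifs with hbc
  · by_cases hb : w.symm b = b
    · by_cases hc : w.symm c = c
      · simp only [Function.comp, hb, hc] at hbc
        omega
      · rw [h' c hc, koszul_zero_right]
    · rw [h' b hb, koszul_zero_left]
  · rfl

theorem permSign_swap [DecidableEq β] {f : β → ℕ} (hf : f.Injective) {b b' : β} (hb : b ≠ b') :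
    permSign f 1 (Equiv.swap b b') = -1 := by
  -- For constant parities the sign does not depend on the ranking. In the ranking `g` the elements
  -- `b` and `b'` come first, so their swap has a single inversion.
  let g : β → ℕ := fun c => if c = b then 0 else if c = b' then 1 else f c + 2
  have hg : g.Injective := by
    intro c d hcd
    simp only [g] at hcd
    split_ifs at hcd <;> first | omega | simp_all
    exact hf (by omega)
  have h1 : permSign f 1 (Equiv.swap b b') = permSign g 1 (Equiv.swap b b') := by
    unfold permSign
    set s := Equiv.swap b b'
    have hfs := hf.comp s.symm.injective
    have hgs := hg.comp s.symm.injective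
    rw [← relSign_mul hf hg hfs, ← relSign_mul hg hgs hfs]
    have := relSign_comp s.symm g f (1 : β → ZMod 2)
    rw [Pi.one_comp] at this
    rw [this, relSign_comm hf hg, mul_comm, mul_assoc, relSign_mul_self, mul_one]
  rw [h1]
  unfold permSign relSign
  rw [Finset.prod_eq_single b, Finset.prod_eq_single b']
  · simp [g, hb.symm, koszul_one_one]
  · intro c _ hc
    rw [if_neg]
    by_cases hcb : c = b
    · simp [hcb]
    · simp [g, Equiv.swap_apply_of_ne_of_ne hcb hc, hcb, hc, hb.symm]
  · simp
  · intro c _ hc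
    refine Finset.prod_eq_one fun d _ => ?_
    rw [if_neg]
    by_cases hcb : c = b'
    · subst hcb
      by_cases hdb : d = b
      · simp [g, hdb, hc]
      · by_cases hdc : d = c
        · simp [hdc]
        · simp [g, Equiv.swap_apply_of_ne_of_ne hdb hdc, hdb, hdc, hc]
    · by_cases hdb : d = b
      · simp [g, hdb]
      · by_cases hdb' : d = b'
        · subst hdb'
          simp [g, hc, hcb, hb.symm]
        · simp [g, Equiv.swap_apply_of_ne_of_ne hc hcb, Equiv.swap_apply_of_ne_of_ne hdb hdb',
            hc, hcb, hdb, hdb']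
          omega
  · simp

/-- The sign acquired by a tensor with factors of parities `ε` in the order of the ranks `f`, when
the `d`-th power of an odd map is applied. -/
def shiftSign (f : β → ℕ) (ε : β → ZMod 2) : ℤ :=
  ∏ b, ∏ c, if f b < f c then koszul 1 (ε b) else 1

theorem shiftSign_mul_self (f : β → ℕ) (ε : β → ZMod 2) :
    shiftSign f ε * shiftSign f ε = 1 := by
  unfold shiftSign
  simp only [← Finset.prod_mul_distrib]
  refine Finset.prod_eq_one fun b _ => Finset.prod_eq_one fun c _ => ?_
  split_ifs
  · exact koszul_mul_self _ _
  · norm_num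

/-- Up to the coboundary of `shiftSign`, changing the parity of all elements multiplies the action
of the symmetric group by the sign character. -/
theorem permSign_mul_permSign_one {f : β → ℕ} (hf : f.Injective) (ε : β → ZMod 2)
    (w : Equiv.Perm β) :
    permSign f ε w * permSign f 1 w =
      permSign f (ε + 1) w * (shiftSign f (ε + 1) * shiftSign f ((ε + 1) ∘ w)) := by
  have h1 : shiftSign f ((ε + 1) ∘ w) =
      ∏ b, ∏ c, if f (w.symm b) < f (w.symm c) then koszul 1 (ε b + 1) else 1 := by
    unfold shiftSign
    rw [← Equiv.prod_comp w.symm]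
    refine Finset.prod_congr rfl fun b _ => ?_
    rw [← Equiv.prod_comp w.symm]
    simp
  rw [h1]
  unfold permSign relSign shiftSign
  simp only [← Finset.prod_mul_distrib]
  refine prod_pairs_congr _ _ (fun b => by simp) fun b c hbc => ?_
  -- If `w` keeps the order of the pair, the two shift factors coincide and cancel. If it inverts
  -- the pair, they belong to different members of the pair, and `koszul_shift` applies.
  have hK := koszul_shift (ε b) (ε c)
  have hb := koszul_mul_self 1 (ε b + 1)
  have hc := koszul_mul_self 1 (ε c + 1)
  rw [koszul_comm (ε c) (ε b)]
  simp only [Pi.add_apply, Pi.one_apply, Function.comp]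
  rw [koszul_comm (ε c + 1) (ε b + 1)]
  rcases lt_or_gt_of_ne (hf.ne hbc) with h1 | h1 <;>
    rcases lt_or_gt_of_ne ((hf.comp w.symm.injective).ne hbc) with h2 | h2 <;>
    simp only [Function.comp] at h2 <;>
    simp [h1, h2, h1.not_gt, h2.not_gt, hK, hb, hc] <;>
  ring

end PairProducts

/-! ### Permutations and words within the lines of a diagram -/

section Lines

variable {β : Type*} {q : ℕ} {n : Fin q → ℕ}

/-- The line of the box `b`, when the boxes are arranged in lines by `e`. -/
def lineOf (e : (Σ i : Fin q, Fin (n i)) ≃ β) (b : β) : Fin q := (e.symm b).1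

/-- The number of the box `b` in the reading along the lines. -/
def lineRank (e : (Σ i : Fin q, Fin (n i)) ≃ β) (b : β) : ℕ := finSigmaFinEquiv (e.symm b)

theorem lineRank_injective (e : (Σ i : Fin q, Fin (n i)) ≃ β) :
    Function.Injective (lineRank e) :=
  Fin.val_injective.comp (finSigmaFinEquiv.injective.comp e.symm.injective)

theorem finSigmaFinEquiv_lt_of_fst_lt {x y : Σ i : Fin q, Fin (n i)} (h : x.1 < y.1) :
    (finSigmaFinEquiv x : ℕ) < finSigmaFinEquiv y := by
  rw [finSigmaFinEquiv_apply, finSigmaFinEquiv_apply]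
  have h1 : ∑ i : Fin (x.1 : ℕ), n (Fin.castLE x.1.2.le i) + n x.1 ≤
      ∑ i : Fin (y.1 : ℕ), n (Fin.castLE y.1.2.le i) := by
    let N : ℕ → ℕ := fun i => if hi : i < q then n ⟨i, hi⟩ else 0
    have hN : ∀ z : Fin q, ∑ i : Fin (z : ℕ), n (Fin.castLE z.2.le i) =
        ∑ i ∈ Finset.range z, N i := by
      intro z
      rw [← Fin.sum_univ_eq_sum_range]
      refine Finset.sum_congr rfl fun i _ => ?_
      have : (i : ℕ) < q := lt_trans i.2 z.2
      simp [N, this, Fin.castLE]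
    have hx : n x.1 = N x.1 := by simp [N]
    rw [hN, hN, hx, ← Finset.sum_range_succ]
    exact Finset.sum_le_sum_of_subset (Finset.range_subset_range.2 h)
  have := x.2.2
  omega

theorem finSigmaFinEquiv_lt_iff_of_fst_eq (i : Fin q) (s t : Fin (n i)) :
    (finSigmaFinEquiv (⟨i, s⟩ : Σ i : Fin q, Fin (n i)) : ℕ) <
      finSigmaFinEquiv (⟨i, t⟩ : Σ i : Fin q, Fin (n i)) ↔ s < t := by
  rw [finSigmaFinEquiv_apply, finSigmaFinEquiv_apply]
  simp

theorem lineRank_lt_of_lineOf_lt (e : (Σ i : Fin q, Fin (n i)) ≃ β) {b c : β}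
    (h : lineOf e b < lineOf e c) : lineRank e b < lineRank e c :=
  finSigmaFinEquiv_lt_of_fst_lt h

/-- The permutations of the boxes that preserve the lines. -/
def lineGroup (e : (Σ i : Fin q, Fin (n i)) ≃ β) : Subgroup (Equiv.Perm β) where
  carrier := {g | ∀ b, lineOf e (g b) = lineOf e b}
  mul_mem' := by
    intro g h hg hh b
    rw [Equiv.Perm.mul_apply, hg, hh]
  one_mem' := fun b => rfl
  inv_mem' := by
    intro g hg b
    rw [← hg]
    exact congrArg (lineOf e) (g.apply_symm_apply b)

theorem mem_lineGroup (e : (Σ i : Fin q, Fin (n i)) ≃ β) (g : Equiv.Perm β) :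
    g ∈ lineGroup e ↔ ∀ b, lineOf e (g b) = lineOf e b := Iff.rfl

variable {ι : Type}

/-- The word formed by the entries of a line. -/
def lineWord (e : (Σ i : Fin q, Fin (n i)) ≃ β) (x : β → ι) (i : Fin q) : Fin (n i) → ι :=
  fun s => x (e ⟨i, s⟩)

/-- No odd letter is repeated in any line. -/
def IsLineRestricted (e : (Σ i : Fin q, Fin (n i)) ≃ β) (p : ι → ZMod 2) (x : β → ι) : Prop :=
  ∀ b c, lineOf e b = lineOf e c → x b = x c → p (x b) = 1 → b = c

theorem isLineRestricted_iff (e : (Σ i : Fin q, Fin (n i)) ≃ β) (p : ι → ZMod 2) (x : β → ι) :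
    IsLineRestricted e p x ↔ ∀ i, IsRestricted p (lineWord e x i) := by
  constructor
  · intro h i s t hst hp
    have := h (e ⟨i, s⟩) (e ⟨i, t⟩) (by simp [lineOf]) hst hp
    simpa using this
  · intro h b c hbc hx hp
    obtain ⟨⟨i, s⟩, rfl⟩ := e.surjective b
    obtain ⟨⟨j, t⟩, rfl⟩ := e.surjective c
    simp only [lineOf, Equiv.symm_apply_apply] at hbc
    subst hbc
    rw [h i s t hx hp]

theorem exists_lineGroup_iff (e : (Σ i : Fin q, Fin (n i)) ≃ β) (x y : β → ι) :
    (∀ i, ∃ τ : Equiv.Perm (Fin (n i)), ∀ s, lineWord e y i s = lineWord e x i (τ s)) ↔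
      ∃ g ∈ lineGroup e, y = x ∘ g := by
  constructor
  · intro h
    choose τ hτ using h
    refine ⟨(e.symm.trans (Equiv.sigmaCongrRight τ)).trans e, ?_, ?_⟩
    · intro b
      simp [lineOf]
    · ext b
      obtain ⟨⟨i, s⟩, rfl⟩ := e.surjective b
      simpa [lineWord] using hτ i s
  · rintro ⟨g, hg, rfl⟩ i
    have hg' : ∀ s, (e.symm (g (e ⟨i, s⟩))).1 = i := fun s => by
      have := hg (e ⟨i, s⟩)
      simpa [lineOf] using this
    let f : Fin (n i) → Fin (n i) := fun s => Fin.cast (by rw [hg' s]) (e.symm (g (e ⟨i, s⟩))).2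
    have hf : ∀ s, (⟨i, f s⟩ : Σ i : Fin q, Fin (n i)) = e.symm (g (e ⟨i, s⟩)) := by
      intro s
      refine Sigma.ext (hg' s).symm ?_
      simp only [f]
      refine (Fin.heq_ext_iff (by rw [hg' s])).2 ?_
      simp
    have hfi : Function.Injective f := by
      intro s t hst
      have h1 := hf s
      rw [hst, hf t] at h1
      simpa using h1.symm
    refine ⟨Equiv.ofBijective f (Finite.injective_iff_bijective.1 hfi), fun s => ?_⟩
    simp [lineWord, hf]

variable [LinearOrder ι]

theorem prod_dualCoeff_eq_zero (e : (Σ i : Fin q, Fin (n i)) ≃ β) (p : ι → ZMod 2) (x y : β → ι)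
    (h : ¬ ∃ g ∈ lineGroup e, y = x ∘ g) :
    ∏ i, dualCoeff p (lineWord e x i) (lineWord e y i) = 0 := by
  rw [← exists_lineGroup_iff] at h
  obtain ⟨i, hi⟩ := not_forall.1 h
  exact Finset.prod_eq_zero (Finset.mem_univ i) (if_neg fun hc => hi hc.2)

variable [Fintype β]

/-- The product over all lines of the signs of the words in the lines. -/
def lineSign (e : (Σ i : Fin q, Fin (n i)) ≃ β) (p : ι → ZMod 2) (x : β → ι) : ℤ :=
  ∏ b, ∏ c, if (lineOf e b = lineOf e c ∧ lineRank e b < lineRank e c) ∧ x c < x b then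
    koszul (p (x b)) (p (x c)) else 1

theorem lineSign_mul_self (e : (Σ i : Fin q, Fin (n i)) ≃ β) (p : ι → ZMod 2) (x : β → ι) :
    lineSign e p x * lineSign e p x = 1 := by
  unfold lineSign
  simp only [← Finset.prod_mul_distrib]
  refine Finset.prod_eq_one fun b _ => Finset.prod_eq_one fun c _ => ?_
  split_ifs
  · exact koszul_mul_self _ _
  · norm_num

theorem prod_wordSign (e : (Σ i : Fin q, Fin (n i)) ≃ β) (p : ι → ZMod 2) (x : β → ι) :
    ∏ i, wordSign p (lineWord e x i) = lineSign e p x := by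
  unfold lineSign wordSign
  rw [← Equiv.prod_comp e, Fintype.prod_sigma]
  refine Finset.prod_congr rfl fun i _ => Finset.prod_congr rfl fun s _ => ?_
  rw [← Equiv.prod_comp e, Fintype.prod_sigma, Finset.prod_eq_single i]
  · refine Finset.prod_congr rfl fun t _ => ?_
    simp only [lineOf, lineRank, Equiv.symm_apply_apply, true_and,
      finSigmaFinEquiv_lt_iff_of_fst_eq]
    rfl
  · intro j _ hj
    refine Finset.prod_eq_one fun t _ => ?_
    rw [if_neg]
    rintro ⟨⟨h, -⟩, -⟩
    simp only [lineOf, Equiv.symm_apply_apply] at h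
    exact hj h.symm
  · simp

/-- Both sides record the sign of passing between two words through their common sorted form. Pairs
in different lines keep their order under `g`. Equal letters in one line are even by restrictedness,
so their order is immaterial. -/
theorem permSign_lineGroup (e : (Σ i : Fin q, Fin (n i)) ≃ β) (p : ι → ZMod 2) (x : β → ι)
    (hx : IsLineRestricted e p x) (g : Equiv.Perm β) (hg : g ∈ lineGroup e) :
    permSign (lineRank e) (p ∘ x) g = lineSign e p x * lineSign e p (x ∘ g) := by
  have h1 : lineSign e p (x ∘ g) = ∏ b, ∏ c,
      if (lineOf e b = lineOf e c ∧ lineRank e (g.symm b) < lineRank e (g.symm c)) ∧ x c < x b then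
        koszul (p (x b)) (p (x c)) else 1 := by
    unfold lineSign
    rw [← Equiv.prod_comp g.symm]
    refine Finset.prod_congr rfl fun b _ => ?_
    rw [← Equiv.prod_comp g.symm]
    refine Finset.prod_congr rfl fun c _ => ?_
    have hb : lineOf e (g.symm b) = lineOf e b := (lineGroup e).inv_mem hg b
    have hc : lineOf e (g.symm c) = lineOf e c := (lineGroup e).inv_mem hg c
    simp [hb, hc]
  rw [h1]
  unfold permSign relSign lineSign
  simp only [← Finset.prod_mul_distrib]
  refine prod_pairs_congr _ _ (fun b => by simp) fun b c hbc => ?_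
  have hK := koszul_mul_self (p (x b)) (p (x c))
  simp only [Function.comp]
  rw [koszul_comm (p (x c)) (p (x b))]
  by_cases hl : lineOf e b = lineOf e c
  · have hinj := lineRank_injective e
    by_cases hxe : x b = x c
    · have hp : p (x b) = 0 := by
        have h2 : p (x b) ≠ 1 := fun hp => hbc (hx b c hl hxe hp)
        generalize p (x b) = a at h2
        revert a; decide
      simp [← hxe, hp, koszul_zero_left]
    · rcases lt_or_gt_of_ne (hinj.ne hbc) with h1 | h1 <;>
      rcases lt_or_gt_of_ne ((hinj.comp g.symm.injective).ne hbc) with h2 | h2 <;>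
      rcases lt_or_gt_of_ne hxe with h3 | h3 <;>
      simp only [Function.comp] at h2 <;>
      simp [hl, h1, h2, h3, h1.not_gt, h2.not_gt, h3.not_gt, hK]
  · have hb : lineOf e (g.symm b) = lineOf e b := (lineGroup e).inv_mem hg b
    have hc : lineOf e (g.symm c) = lineOf e c := (lineGroup e).inv_mem hg c
    rcases lt_or_gt_of_ne hl with h1 | h1
    · have h2 := lineRank_lt_of_lineOf_lt e h1
      rw [← hb, ← hc] at h1
      have h3 := lineRank_lt_of_lineOf_lt e h1
      simp [hl, Ne.symm hl, h2, h3, h2.not_gt, h3.not_gt]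
    · have h2 := lineRank_lt_of_lineOf_lt e h1
      rw [← hb, ← hc] at h1
      have h3 := lineRank_lt_of_lineOf_lt e h1
      simp [hl, Ne.symm hl, h2, h3, h2.not_gt, h3.not_gt]

theorem prod_dualCoeff_comp (e : (Σ i : Fin q, Fin (n i)) ≃ β) (p : ι → ZMod 2) (x : β → ι)
    (hx : IsLineRestricted e p x) (g : Equiv.Perm β) (hg : g ∈ lineGroup e) :
    ∏ i, dualCoeff p (lineWord e x i) (lineWord e (x ∘ g) i) =
      lineSign e p x * lineSign e p (x ∘ g) := by
  rw [← prod_wordSign, ← prod_wordSign, ← Finset.prod_mul_distrib]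
  refine Finset.prod_congr rfl fun i _ => ?_
  rw [dualCoeff, if_pos]
  exact ⟨(isLineRestricted_iff e p x).1 hx i, (exists_lineGroup_iff e x _).2 ⟨g, hg, rfl⟩ i⟩

end Lines

/-! ### Rearranging values, and weights that measure sortedness -/

section Permutations

variable {β : Type*} [Fintype β]

/-- The rearrangements of the values of `f` within a set containing all boxes where `f ∘ w` differs
from `f`. -/
theorem exists_perm_comp_eq {γ : Type*} (f : β → γ) (w : Equiv.Perm β) (P : β → Prop)
    (h : ∀ b, f (w b) ≠ f b → P b) :
    ∃ v : Equiv.Perm β, (∀ b, v b ≠ b → P b) ∧ (∀ b, P b → P (v b)) ∧ ∀ b, f (v b) = f (w b) := by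
  classical
  -- The fibres of `f ∘ w` and `f` over `k` have equal size and the same part outside `P`, hence
  -- parts of equal size inside `P`. Matching these parts gives the permutation.
  have hcard : ∀ k, Fintype.card {y : {b // P b} // f (w y) = k} =
      Fintype.card {y : {b // P b} // f y = k} := by
    intro k
    have h1 : ∀ g : β → γ, Fintype.card {y : {b // P b} // g y = k} =
        (Finset.univ.filter fun b => g b = k ∧ P b).card := by
      intro g
      rw [← Fintype.card_subtype]
      exact Fintype.card_congr ((Equiv.subtypeSubtypeEquivSubtypeInter P (fun b => g b = k)).trans
        (Equiv.subtypeEquivRight fun b => and_comm))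
    rw [h1 (fun b => f (w b)), h1 f]
    have h2 : (Finset.univ.filter fun b => f (w b) = k).card =
        (Finset.univ.filter fun b => f b = k).card :=
      Finset.card_bij (fun b _ => w b) (by simp) (by simp)
        (fun b hb => ⟨w.symm b, by simpa using hb, by simp⟩)
    have h3 : (Finset.univ.filter fun b => f (w b) = k ∧ ¬ P b) =
        (Finset.univ.filter fun b => f b = k ∧ ¬ P b) := by
      ext b
      simp only [Finset.mem_filter, Finset.mem_univ, true_and, and_congr_left_iff]
      intro hb
      rw [not_not.1 fun hne => hb (h b hne)]
    have h4 := Finset.card_filter_add_card_filter_not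
      (s := Finset.univ.filter fun b => f (w b) = k) P
    have h5 := Finset.card_filter_add_card_filter_not (s := Finset.univ.filter fun b => f b = k) P
    rw [Finset.filter_filter, Finset.filter_filter] at h4 h5
    rw [h3] at h4
    omega
  let σ : Equiv.Perm {b // P b} :=
    ((Equiv.sigmaFiberEquiv fun y : {b // P b} => f (w y)).symm.trans
      (Equiv.sigmaCongrRight fun k => Fintype.equivOfCardEq (hcard k))).trans
      (Equiv.sigmaFiberEquiv fun y : {b // P b} => f y)
  have hσ : ∀ y, f (σ y) = f (w y) := fun y =>
    (Fintype.equivOfCardEq (hcard (f (w y))) ⟨y, rfl⟩).2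
  refine ⟨Equiv.Perm.ofSubtype σ, fun b hb => ?_, fun b hb => ?_, fun b => ?_⟩
  · by_contra hP
    exact hb (Equiv.Perm.ofSubtype_apply_of_not_mem σ hP)
  · rw [Equiv.Perm.ofSubtype_apply_of_mem σ hb]
    exact (σ ⟨b, hb⟩).2
  · by_cases hb : P b
    · rw [Equiv.Perm.ofSubtype_apply_of_mem σ hb, hσ]
    · rw [Equiv.Perm.ofSubtype_apply_of_not_mem σ hb]
      exact (not_not.1 fun hne => hb (h b hne)).symm

/-- The sum grows by `(x b - x c) * (wt c - wt b)`. This makes the sorting procedures for rows and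
for words terminate. -/
theorem sum_swap_lt [DecidableEq β] (x wt : β → ℤ) {b c : β} (hx : x c < x b)
    (hwt : wt b < wt c) :
    ∑ a, x a * wt a < ∑ a, x (Equiv.swap b c a) * wt a := by
  have hbc : b ≠ c := fun h => by simp [h] at hx
  rw [← sub_pos, ← Finset.sum_sub_distrib, Finset.sum_eq_add b c hbc]
  · simp only [Equiv.swap_apply_left, Equiv.swap_apply_right]
    nlinarith
  · rintro a - ⟨hb, hc⟩
    rw [Equiv.swap_apply_of_ne_of_ne hb hc, sub_self]
  · simp
  · simp

/-- The permutations that fix all elements outside `X`. -/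
def supportedGroup (X : Finset β) : Subgroup (Equiv.Perm β) where
  carrier := {w | ∀ b, b ∉ X → w b = b}
  mul_mem' := by
    intro g h hg hh b hb
    rw [Equiv.Perm.mul_apply, hh b hb, hg b hb]
  one_mem' := fun b _ => rfl
  inv_mem' := by
    intro g hg b hb
    exact (Equiv.symm_apply_eq g).2 (hg b hb).symm

end Permutations

noncomputable instance lineGroupFintype {β : Type*} [Fintype β] {q : ℕ} {n : Fin q → ℕ}
    (e : (Σ i : Fin q, Fin (n i)) ≃ β) : Fintype (lineGroup e) := Fintype.ofFinite _

noncomputable instance supportedGroupFintype {β : Type*} [Fintype β] (X : Finset β) :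
    Fintype (supportedGroup X) := Fintype.ofFinite _

/-! ### The signed symmetrizer and the Garnir relations -/

section Symmetrizer

variable {β : Type*} [Fintype β] {ι : Type}
  {q q' : ℕ} {n : Fin q → ℕ} {n' : Fin q' → ℕ}
  (e : (Σ i : Fin q, Fin (n i)) ≃ β) (e' : (Σ i : Fin q', Fin (n' i)) ≃ β)
  (p : ι → ZMod 2)

/-- The sign of the action of `w` on the tensor with entries `x`, twisted by the sign character. -/
def twistSign (x : β → ι) (w : Equiv.Perm β) : ℤ :=
  permSign (lineRank e) (p ∘ x) w * permSign (lineRank e) 1 w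

theorem twistSign_mul (x : β → ι) (w w' : Equiv.Perm β) :
    twistSign e p x (w * w') = twistSign e p x w * twistSign e p (x ∘ w) w' := by
  unfold twistSign
  rw [permSign_mul (lineRank_injective e), permSign_mul (lineRank_injective e), Pi.one_comp]
  simp only [Function.comp_assoc]
  ring

theorem twistSign_mul_self (x : β → ι) (w : Equiv.Perm β) :
    twistSign e p x w * twistSign e p x w = 1 := by
  unfold twistSign
  rw [mul_mul_mul_comm, permSign_mul_self, permSign_mul_self, mul_one]

/-- A permutation of equal odd entries acts by its sign. -/
theorem twistSign_eq_one (x : β → ι) (w : Equiv.Perm β) (hx : x ∘ w = x)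
    (h : ∀ b, w b ≠ b → p (x b) = 1) : twistSign e p x w = 1 := by
  unfold twistSign
  -- After the parity shift the moved entries are even and give no sign, and the coboundary is
  -- trivial because `w` preserves `x`.
  rw [permSign_mul_permSign_one (lineRank_injective e), permSign_eq_one]
  · have : ((p ∘ x) + 1) ∘ w = (p ∘ x) + 1 := by
      ext b
      simp [show x (w b) = x b from congrFun hx b]
    rw [this, shiftSign_mul_self, mul_one]
  · intro b hb
    simp only [Pi.add_apply, Function.comp, h b hb, Pi.one_apply]
    decide

open Classical in
/-- The indicator of the equality of two fillings. -/
noncomputable def fillingDelta (x s : β → ι) : ℤ := if x = s then 1 else 0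

/-- The coefficient at `s` of the tensor with entries `x`, symmetrized along the lines of `e` with
signs and then along the lines of `e'`. -/
noncomputable def symCoeff (x s : β → ι) : ℤ :=
  ∑ r : lineGroup e, ∑ c : lineGroup e', fillingDelta (x ∘ (r.1 * c.1 : Equiv.Perm β)) s *
      (twistSign e p x (r.1 * c.1) * permSign (lineRank e) 1 c.1)

/-- Translation by `r` merely reindexes the sum over the row group. -/
theorem symCoeff_comp (x s : β → ι) (r : Equiv.Perm β) (hr : r ∈ lineGroup e) :
    symCoeff e e' p x s = twistSign e p x r * symCoeff e e' p (x ∘ r) s := by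
  unfold symCoeff
  rw [← Equiv.sum_comp (Equiv.mulLeft (⟨r, hr⟩ : lineGroup e)), Finset.mul_sum]
  refine Finset.sum_congr rfl fun r' _ => ?_
  rw [Finset.mul_sum]
  refine Finset.sum_congr rfl fun c _ => ?_
  simp only [Equiv.coe_mulLeft, Subgroup.coe_mul, mul_assoc]
  rw [twistSign_mul e p x r, Function.comp_assoc, ← Equiv.Perm.coe_mul]
  ring

/-- The Garnir relation. -/
theorem sum_symCoeff_eq_zero [DecidableEq β] (x s : β → ι) (X : Finset β)
    (hX : ∀ r ∈ lineGroup e, ∃ b ∈ X, ∃ b' ∈ X, b ≠ b' ∧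
      lineOf e' (r.symm b) = lineOf e' (r.symm b')) :
    ∑ w : supportedGroup X, twistSign e p x w.1 * symCoeff e e' p (x ∘ w.1) s = 0 := by
  unfold symCoeff
  simp only [Finset.mul_sum]
  rw [Finset.sum_comm]
  refine Finset.sum_eq_zero fun r _ => ?_
  obtain ⟨b, hb, b', hb', hne, hl⟩ := hX r.1 r.2
  -- For fixed `r`, the swap of `b` and `b'` can be moved past `r`, where it becomes a swap within a
  -- column. Inserting it after `w` and its conjugate before `c` leaves the product `w * (r * c)`
  -- unchanged but reverses the sign `permSign (lineRank e) 1 c`, so the sum over `w` and `c` is its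
  -- own negative.
  have hτ : Equiv.swap b b' ∈ supportedGroup X := fun c hc =>
    Equiv.swap_apply_of_ne_of_ne (fun h => hc (h ▸ hb)) (fun h => hc (h ▸ hb'))
  have hτ' : Equiv.swap (r.1.symm b) (r.1.symm b') ∈ lineGroup e' := by
    intro c
    rw [Equiv.swap_apply_def]
    split_ifs with h1 h2
    · rw [h1, hl]
    · rw [h2, hl]
    · rfl
  have hconj : ∀ w c : Equiv.Perm β,
      w * Equiv.swap b b' * (r.1 * (Equiv.swap (r.1.symm b) (r.1.symm b') * c)) =
        w * (r.1 * c) := by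
    intro w c
    have h1 : Equiv.swap b b' * r.1 = r.1 * Equiv.swap (r.1.symm b) (r.1.symm b') := by
      have := Equiv.mul_swap_eq_swap_mul r.1 (r.1.symm b) (r.1.symm b')
      simpa using this.symm
    calc _ = w * (Equiv.swap b b' * r.1) * Equiv.swap (r.1.symm b) (r.1.symm b') * c := by group
      _ = w * r.1 * (Equiv.swap (r.1.symm b) (r.1.symm b') *
          Equiv.swap (r.1.symm b) (r.1.symm b')) * c := by rw [h1]; group
      _ = _ := by rw [Equiv.swap_mul_self, mul_one, mul_assoc]
  have hsgn : ∀ c : Equiv.Perm β, permSign (lineRank e) 1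
      (Equiv.swap (r.1.symm b) (r.1.symm b') * c) = - permSign (lineRank e) 1 c := by
    intro c
    rw [permSign_mul (lineRank_injective e), Pi.one_comp,
      permSign_swap (lineRank_injective e) (r.1.symm.injective.ne hne), neg_one_mul]
  have hanti : ∀ S : ℤ, S = -S → S = 0 := fun S hS => by omega
  apply hanti
  rw [← Finset.sum_neg_distrib]
  refine (Equiv.sum_comp (Equiv.mulRight (⟨_, hτ⟩ : supportedGroup X)) _).symm.trans ?_
  refine Finset.sum_congr rfl fun w _ => ?_
  rw [← Finset.sum_neg_distrib]
  refine (Equiv.sum_comp (Equiv.mulLeft (⟨_, hτ'⟩ : lineGroup e')) _).symm.trans ?_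
  refine Finset.sum_congr rfl fun c _ => ?_
  have hF : ∀ v v' c : Equiv.Perm β, twistSign e p x v *
      (fillingDelta ((x ∘ v) ∘ v') s * (twistSign e p (x ∘ v) v' * permSign (lineRank e) 1 c)) =
      fillingDelta (x ∘ (v * v')) s * twistSign e p x (v * v') * permSign (lineRank e) 1 c := by
    intro v v' c
    rw [twistSign_mul, Equiv.Perm.coe_mul, Function.comp_assoc]
    ring
  rw [hF, hF, ← mul_neg, ← hsgn]
  simp only [Equiv.coe_mulLeft, Equiv.coe_mulRight, Subgroup.coe_mul, hconj]

end Symmetrizer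

/-! ### Straightening over the rational numbers -/

section Straightening

variable {lam mu : YoungDiagram} {m : ℕ}

noncomputable instance boxFintype (lam mu : YoungDiagram) : Fintype (Box lam mu) :=
  Fintype.ofEquiv _ (rowBox lam mu)

theorem lineOf_rowBox (b : Box lam mu) : (lineOf (rowBox lam mu) b : ℕ) = b.1.1 := rfl

theorem lineOf_colBox (b : Box lam mu) : (lineOf (colBox lam mu) b : ℕ) = b.1.2 := rfl

theorem mem_lineGroup_rowBox (g : Equiv.Perm (Box lam mu)) :
    g ∈ lineGroup (rowBox lam mu) ↔ ∀ b, (g b).1.1 = b.1.1 := by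
  simp only [mem_lineGroup, Fin.ext_iff, lineOf_rowBox]

theorem mem_lineGroup_colBox (g : Equiv.Perm (Box lam mu)) :
    g ∈ lineGroup (colBox lam mu) ↔ ∀ b, (g b).1.2 = b.1.2 := by
  simp only [mem_lineGroup, Fin.ext_iff, lineOf_colBox]

/-- The sum of the entries, weighted by the row numbers. -/
noncomputable def rowWeight (x : Tableau lam mu (Fin m)) : ℤ :=
  ∑ b, ((x b : ℕ) : ℤ) * (b.1.1 : ℤ)

/-- The sum of the entries, weighted by the column numbers. -/
noncomputable def colWeight (x : Tableau lam mu (Fin m)) : ℤ :=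
  ∑ b, ((x b : ℕ) : ℤ) * (b.1.2 : ℤ)

theorem rowWeight_comp (x : Tableau lam mu (Fin m)) (g : Equiv.Perm (Box lam mu))
    (hg : g ∈ lineGroup (rowBox lam mu)) : rowWeight (x ∘ g) = rowWeight x := by
  rw [mem_lineGroup_rowBox] at hg
  unfold rowWeight
  rw [← Equiv.sum_comp g (fun b => ((x b : ℕ) : ℤ) * (b.1.1 : ℤ))]
  simp [hg]

theorem colWeight_comp (x : Tableau lam mu (Fin m)) (g : Equiv.Perm (Box lam mu))
    (hg : g ∈ lineGroup (colBox lam mu)) : colWeight (x ∘ g) = colWeight x := by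
  rw [mem_lineGroup_colBox] at hg
  unfold colWeight
  rw [← Equiv.sum_comp g (fun b => ((x b : ℕ) : ℤ) * (b.1.2 : ℤ))]
  simp [hg]

variable (p : Fin m → ZMod 2)

theorem twistSign_exchange (x : Tableau lam mu (Fin m)) (a a' : Box lam mu)
    (ha : a.1.1 < a'.1.1) (hx : x a' ≤ x a) (hp : x a = x a' → p (x a) = 1)
    (X : Finset (Box lam mu))
    (hX : ∀ b ∈ X, (b.1.1 = a.1.1 ∧ x a ≤ x b) ∨ (b.1.1 = a'.1.1 ∧ x b ≤ x a'))
    (w : Equiv.Perm (Box lam mu)) (hw : w ∈ supportedGroup X) :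
    rowWeight x < rowWeight (x ∘ w) ∨ ∃ r ∈ lineGroup (rowBox lam mu), x ∘ w = x ∘ r ∧
      twistSign (rowBox lam mu) p x w * twistSign (rowBox lam mu) p x r = 1 := by
  have hw' : ∀ b, b ∉ X → w.symm b = b := (supportedGroup X).inv_mem hw
  have hwX : ∀ b ∈ X, w.symm b ∈ X := fun b hb => by
    by_contra hc
    have h1 : b = w.symm b := by simpa using hw _ hc
    exact hc (h1 ▸ hb)
  -- The entry of `b` ends in the box `w.symm b`. The total of the row numbers does not change, so
  -- the entries may be measured from any origin `c`.
  have hdiff : ∀ c : ℤ, rowWeight (x ∘ w) - rowWeight x =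
      ∑ b, (((x b : ℕ) : ℤ) - c) * (((w.symm b).1.1 : ℤ) - (b.1.1 : ℤ)) := by
    intro c
    have h1 : rowWeight (x ∘ w) = ∑ b, ((x b : ℕ) : ℤ) * ((w.symm b).1.1 : ℤ) := by
      unfold rowWeight
      rw [← Equiv.sum_comp w (fun b => ((x b : ℕ) : ℤ) * ((w.symm b).1.1 : ℤ))]
      simp
    have h2 : ∑ b, ((w.symm b).1.1 : ℤ) = ∑ b : Box lam mu, (b.1.1 : ℤ) :=
      Equiv.sum_comp w.symm (fun b : Box lam mu => (b.1.1 : ℤ))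
    have h3 : ∀ b, (((x b : ℕ) : ℤ) - c) * (((w.symm b).1.1 : ℤ) - (b.1.1 : ℤ)) =
        ((x b : ℕ) : ℤ) * ((w.symm b).1.1 : ℤ) - ((x b : ℕ) : ℤ) * (b.1.1 : ℤ) -
        c * ((w.symm b).1.1 : ℤ) + c * (b.1.1 : ℤ) := fun b => by ring
    simp only [h3, Finset.sum_add_distrib, Finset.sum_sub_distrib, ← Finset.mul_sum, h2]
    rw [h1, rowWeight]
    ring
  by_cases hlt : rowWeight x < rowWeight (x ∘ w)
  · exact Or.inl hlt
  refine Or.inr ?_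
  -- For such `c` no summand of `hdiff` is negative: entries from the upper row are at least `c` and
  -- can only move down, those from the lower row are at most `c` and can only move up. When the row
  -- weight does not grow, all summands vanish, so an entry that changes its row equals `c`.
  have hmoved : ∀ c : Fin m, x a' ≤ c → c ≤ x a → ∀ b, (w.symm b).1.1 ≠ b.1.1 → x b = c := by
    intro c hc1 hc2 b hb
    have hnonneg : ∀ b ∈ Finset.univ, 0 ≤ (((x b : ℕ) : ℤ) - ((c : ℕ) : ℤ)) *
        (((w.symm b).1.1 : ℤ) - (b.1.1 : ℤ)) := by
      intro b _
      by_cases hbX : b ∈ X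
      · rcases hX b hbX with ⟨h1, h2⟩ | ⟨h1, h2⟩
        · refine mul_nonneg ?_ ?_
          · have := hc2.trans h2
            rw [Fin.le_def] at this
            omega
          · rcases hX _ (hwX b hbX) with ⟨h3, -⟩ | ⟨h3, -⟩ <;> omega
        · refine mul_nonneg_of_nonpos_of_nonpos ?_ ?_
          · have := h2.trans hc1
            rw [Fin.le_def] at this
            omega
          · rcases hX _ (hwX b hbX) with ⟨h3, -⟩ | ⟨h3, -⟩ <;> omega
      · rw [hw' b hbX]
        simp
    have hsum := hdiff (c : ℕ)
    have hzero := (Finset.sum_eq_zero_iff_of_nonneg hnonneg).1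
      (le_antisymm (by omega) (Finset.sum_nonneg hnonneg)) b (Finset.mem_univ b)
    rcases mul_eq_zero.1 hzero with h | h
    · exact Fin.ext (by omega)
    · exact absurd (by omega) hb
  -- If the two entries differ, using both as `c` shows that no entry changes its row, and `w`
  -- itself is a row permutation. If they agree, all entries that change rows equal one odd letter,
  -- and a permutation `v` of boxes holding this letter undoes the row changes without a sign.
  by_cases heq : x a = x a'
  · obtain ⟨v, hv1, hv2, hv3⟩ := exists_perm_comp_eq (fun b : Box lam mu => b.1.1) w.symm
      (fun b => x b = x a) (hmoved (x a) hx le_rfl)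
    have hxv : x ∘ v = x := by
      ext1 b
      by_cases hb : v b = b
      · simp [hb]
      · simp only [Function.comp]
        rw [hv1 b hb, hv2 b (hv1 b hb)]
    refine ⟨v * w, (mem_lineGroup_rowBox _).2 fun b => ?_, ?_, ?_⟩
    · rw [Equiv.Perm.mul_apply, hv3, Equiv.symm_apply_apply]
    · rw [Equiv.Perm.coe_mul, ← Function.comp_assoc, hxv]
    · rw [twistSign_mul, hxv, twistSign_eq_one _ p x v hxv, one_mul, twistSign_mul_self]
      intro b hb
      rw [hv1 b hb, hp heq]
  · refine ⟨w, ?_, rfl, twistSign_mul_self _ _ _ _⟩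
    have : w⁻¹ ∈ lineGroup (rowBox lam mu) := by
      rw [mem_lineGroup_rowBox]
      intro b
      by_contra hb
      exact heq ((hmoved (x a) hx le_rfl b hb).symm.trans (hmoved (x a') le_rfl hx b hb))
    simpa using inv_mem this

/-- A union of the end of a row and of the beginning of a lower row, both containing the same
column, has two boxes in the same column after any permutation of the boxes within the rows. -/
theorem exists_same_column (a a' : Box lam mu) (ha : a.1.1 < a'.1.1) (hc : a.1.2 = a'.1.2)
    (X : Finset (Box lam mu))
    (hX : ∀ b : Box lam mu, b ∈ X ↔
      (b.1.1 = a.1.1 ∧ a.1.2 ≤ b.1.2) ∨ (b.1.1 = a'.1.1 ∧ b.1.2 ≤ a.1.2))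
    (r : Equiv.Perm (Box lam mu)) (hr : r ∈ lineGroup (rowBox lam mu)) :
    ∃ b ∈ X, ∃ b' ∈ X, b ≠ b' ∧
      lineOf (colBox lam mu) (r.symm b) = lineOf (colBox lam mu) (r.symm b') := by
  have hr' : ∀ b, (r.symm b).1.1 = b.1.1 := (mem_lineGroup_rowBox _).1 (inv_mem hr)
  -- Both row lengths decrease downwards, so this interval contains every column met by either of
  -- the two rows.
  set I := Finset.Ico (mu.rowLen a'.1.1) (lam.rowLen a.1.1) with hI
  have hbox : ∀ b : Box lam mu, mu.rowLen b.1.1 ≤ b.1.2 ∧ b.1.2 < lam.rowLen b.1.1 := by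
    rintro ⟨⟨i, j⟩, h1, h2⟩
    rw [YoungDiagram.mem_iff_lt_rowLen] at h1 h2
    exact ⟨not_lt.1 h2, h1⟩
  have hlam := lam.rowLen_anti _ _ ha.le
  have hmu := mu.rowLen_anti _ _ ha.le
  have hmaps : Set.MapsTo (fun b : Box lam mu => (r.symm b).1.2) X I := by
    intro b hb
    have h1 := hbox (r.symm b)
    rw [hr'] at h1
    change (r.symm b).1.2 ∈ (I : Set ℕ)
    rw [Finset.mem_coe, hI, Finset.mem_Ico]
    rcases (hX b).1 hb with ⟨h, -⟩ | ⟨h, -⟩ <;> rw [h] at h1 <;> omega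
  have ha'X : a' ∈ X := (hX a').2 (Or.inr ⟨rfl, hc.ge⟩)
  have hcard : I.card < X.card := by
    -- Without `a'`, the set `X` still has a box in each column of `I`: in the lower row to the left
    -- of the column of `a`, in the upper row from that column on. Hence `X` has more boxes than `I`
    -- has columns.
    have hsurj : Set.SurjOn (fun b : Box lam mu => b.1.2) (X.erase a' : Finset _) I := by
      intro c hcI
      rw [Finset.mem_coe, hI, Finset.mem_Ico] at hcI
      have h1 := hbox a
      have h2 := hbox a'
      by_cases hcj : c < a.1.2
      · refine ⟨⟨(a'.1.1, c), ?_, ?_⟩, ?_, rfl⟩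
        · rw [YoungDiagram.mem_iff_lt_rowLen]; omega
        · rw [YoungDiagram.mem_iff_lt_rowLen]; omega
        · rw [Finset.mem_coe, Finset.mem_erase, hX]
          refine ⟨fun h => ?_, Or.inr ⟨rfl, hcj.le⟩⟩
          rw [← h] at hc
          simp only at hc
          omega
      · refine ⟨⟨(a.1.1, c), ?_, ?_⟩, ?_, rfl⟩
        · rw [YoungDiagram.mem_iff_lt_rowLen]; omega
        · rw [YoungDiagram.mem_iff_lt_rowLen]; omega
        · rw [Finset.mem_coe, Finset.mem_erase, hX]
          refine ⟨fun h => ?_, Or.inl ⟨rfl, not_lt.1 hcj⟩⟩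
          rw [← h] at ha
          simp at ha
    exact (Finset.card_le_card_of_surjOn _ hsurj).trans_lt (Finset.card_erase_lt_of_mem ha'X)
  obtain ⟨b, hb, b', hb', hne, h⟩ := Finset.exists_ne_map_eq_of_card_lt_of_maps_to hcard hmaps
  exact ⟨b, hb, b', hb', hne, Fin.ext h⟩

/-- The coefficients of the symmetrization of the tensor with entries `x`. -/
noncomputable def symVec (x : Tableau lam mu (Fin m)) : Tableau lam mu (Fin m) → ℚ :=
  fun s => (symCoeff (rowBox lam mu) (colBox lam mu) p x s : ℚ)

theorem symVec_comp (x : Tableau lam mu (Fin m)) (r : Equiv.Perm (Box lam mu))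
    (hr : r ∈ lineGroup (rowBox lam mu)) :
    symVec p x = (twistSign (rowBox lam mu) p x r : ℚ) • symVec p (x ∘ r) := by
  ext s
  simp only [symVec, Pi.smul_apply, smul_eq_mul]
  rw [symCoeff_comp _ _ p x s r hr]
  push_cast
  rfl

/-- Swapping two equal even entries costs nothing in the super action, so only the sign character
remains and `symVec p x` equals its negative. -/
theorem symVec_eq_zero (x : Tableau lam mu (Fin m)) (b c : Box lam mu) (hbc : b ≠ c)
    (hrow : b.1.1 = c.1.1) (hx : x b = x c) (hp : p (x b) = 0) : symVec p x = 0 := by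
  classical
  have hmem : Equiv.swap b c ∈ lineGroup (rowBox lam mu) := by
    rw [mem_lineGroup_rowBox]
    intro d
    rw [Equiv.swap_apply_def]
    split_ifs with h1 h2
    · rw [h1, hrow]
    · rw [h2, hrow]
    · rfl
  have hcomp : x ∘ Equiv.swap b c = x := by
    ext1 d
    simp only [Function.comp, Equiv.swap_apply_def]
    split_ifs with h1 h2
    · rw [h1, hx]
    · rw [h2, hx]
    · rfl
  have hsign : twistSign (rowBox lam mu) p x (Equiv.swap b c) = -1 := by
    unfold twistSign
    rw [permSign_swap (lineRank_injective _) hbc, permSign_eq_one, one_mul]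
    intro d hd
    by_cases h1 : d = b
    · rw [h1]; exact hp
    · by_cases h2 : d = c
      · rw [h2]; simp only [Function.comp, ← hx, hp]
      · exact absurd (Equiv.swap_apply_of_ne_of_ne h1 h2) hd
  have h := symVec_comp p x _ hmem
  rw [hcomp, hsign] at h
  ext s
  have := congrFun h s
  simp only [Int.cast_neg, Int.cast_one, Pi.smul_apply, smul_eq_mul] at this
  simp only [Pi.zero_apply]
  linarith

/-- The straightening law over the rational numbers. -/
theorem symVec_mem_span (x : Tableau lam mu (Fin m)) :
    symVec p x ∈ Submodule.span ℚ (Set.range fun t : {t : Tableau lam mu (Fin m) //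
      IsCostandard p t} => symVec p t.1) := by
  classical
  -- Garnir terms raise the row weight, while sorting a row keeps it and raises the column weight.
  -- Since there are finitely many fillings, the induction may run downwards from the largest
  -- weights.
  let R : Tableau lam mu (Fin m) → Tableau lam mu (Fin m) → Prop := fun y x =>
    rowWeight x < rowWeight y ∨ (rowWeight x = rowWeight y ∧ colWeight x < colWeight y)
  have hwf : WellFounded R := by
    have : IsTrans _ R := ⟨fun a b c h1 h2 => by simp only [R] at *; omega⟩
    have : Std.Irrefl R := ⟨fun a h => by simp only [R] at *; omega⟩
    exact Finite.wellFounded_of_trans_of_irrefl R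
  induction x using hwf.induction with
  | _ x ih =>
  set U := Submodule.span ℚ (Set.range fun t : {t : Tableau lam mu (Fin m) //
      IsCostandard p t} => symVec p t.1)
  by_cases hrow : IsRowCostandard p x
  · by_cases hcol : IsColCostandard p x
    · exact Submodule.subset_span ⟨⟨x, hrow, hcol⟩, rfl⟩
    · unfold IsColCostandard at hcol
      push Not at hcol
      obtain ⟨a, a', hc, ha, hviol⟩ := hcol
      have hle : x a' ≤ x a := by
        by_contra hlt
        have := hviol (not_le.1 hlt).le
        exact hlt this.1.ge
      have hpa : x a = x a' → p (x a) = 1 := by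
        intro h
        have := (hviol h.le).2
        generalize p (x a) = z at this
        revert z; decide
      -- The Garnir set: the upper row from `a` onwards and the lower row up to `a'`. As rows are
      -- sorted, its entries are at least `x a` above and at most `x a'` below.
      let X : Finset (Box lam mu) := Finset.univ.filter fun b =>
        (b.1.1 = a.1.1 ∧ a.1.2 ≤ b.1.2) ∨ (b.1.1 = a'.1.1 ∧ b.1.2 ≤ a.1.2)
      have hX : ∀ b : Box lam mu, b ∈ X ↔
          (b.1.1 = a.1.1 ∧ a.1.2 ≤ b.1.2) ∨ (b.1.1 = a'.1.1 ∧ b.1.2 ≤ a.1.2) := by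
        intro b
        simp [X]
      have hXx : ∀ b ∈ X, (b.1.1 = a.1.1 ∧ x a ≤ x b) ∨ (b.1.1 = a'.1.1 ∧ x b ≤ x a') := by
        intro b hb
        rcases (hX b).1 hb with ⟨h1, h2⟩ | ⟨h1, h2⟩
        · refine Or.inl ⟨h1, ?_⟩
          rcases h2.lt_or_eq with h3 | h3
          · exact (hrow a b h1.symm h3).1
          · rw [show a = b from Subtype.ext (Prod.ext h1.symm h3)]
        · refine Or.inr ⟨h1, ?_⟩
          rw [hc] at h2
          rcases h2.lt_or_eq with h3 | h3
          · exact (hrow b a' h1 h3).1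
          · rw [show b = a' from Subtype.ext (Prod.ext h1 h3)]
      have hG : ∑ w : supportedGroup X, (twistSign (rowBox lam mu) p x w.1 : ℚ) •
          symVec p (x ∘ w.1) = 0 := by
        ext s
        have := sum_symCoeff_eq_zero (rowBox lam mu) (colBox lam mu) p x s X
          (exists_same_column a a' ha hc X hX)
        simp only [Finset.sum_apply, Pi.smul_apply, symVec, smul_eq_mul, Pi.zero_apply]
        exact_mod_cast this
      rw [← Finset.sum_filter_add_sum_filter_not _
        (fun w : supportedGroup X => rowWeight x < rowWeight (x ∘ w.1))] at hG
      have h1 : ∑ w ∈ Finset.univ.filter (fun w : supportedGroup X =>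
          rowWeight x < rowWeight (x ∘ w.1)), (twistSign (rowBox lam mu) p x w.1 : ℚ) •
          symVec p (x ∘ w.1) ∈ U := by
        refine Submodule.sum_mem _ fun w hw => Submodule.smul_mem _ _ (ih _ ?_)
        exact Or.inl (Finset.mem_filter.1 hw).2
      -- Every term that does not raise the row weight is a row rearrangement of `x` with the
      -- matching sign. The Garnir relation thus contains `symVec p x` with a positive multiplicity,
      -- the identity being counted; dividing by it is the reason for working over `ℚ`.
      have h2 : ∀ w ∈ Finset.univ.filter (fun w : supportedGroup X =>
          ¬ rowWeight x < rowWeight (x ∘ w.1)), (twistSign (rowBox lam mu) p x w.1 : ℚ) •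
          symVec p (x ∘ w.1) = symVec p x := by
        intro w hw
        obtain ⟨r, hr, hxr, hs⟩ := (twistSign_exchange p x a a' ha hle hpa X hXx
          w.1 w.2).resolve_left (Finset.mem_filter.1 hw).2
        have hrr := twistSign_mul_self (rowBox lam mu) p x r
        rw [hxr, symVec_comp p x r hr, ← mul_one (twistSign (rowBox lam mu) p x w.1), ← hrr,
          ← mul_assoc, hs, one_mul]
      rw [Finset.sum_congr rfl h2, Finset.sum_const, ← Nat.cast_smul_eq_nsmul ℚ] at hG
      have hcard : ((Finset.univ.filter (fun w : supportedGroup X =>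
          ¬ rowWeight x < rowWeight (x ∘ w.1))).card : ℚ) ≠ 0 := by
        rw [Nat.cast_ne_zero, ← Nat.pos_iff_ne_zero, Finset.card_pos]
        exact ⟨1, by simp⟩
      rw [← Submodule.smul_mem_iff U hcard, eq_neg_of_add_eq_zero_right hG]
      exact U.neg_mem h1
  · unfold IsRowCostandard at hrow
    push Not at hrow
    obtain ⟨b, c, hr, hbc, hviol⟩ := hrow
    have hne : b ≠ c := fun h => by simp [h] at hbc
    by_cases hlt : x c < x b
    · have hmem : Equiv.swap b c ∈ lineGroup (rowBox lam mu) := by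
        rw [mem_lineGroup_rowBox]
        intro d
        rw [Equiv.swap_apply_def]
        split_ifs with h1 h2
        · rw [h1, hr]
        · rw [h2, hr]
        · rfl
      rw [symVec_comp p x _ hmem]
      refine Submodule.smul_mem _ _ (ih _ (Or.inr ⟨(rowWeight_comp x _ hmem).symm, ?_⟩))
      exact sum_swap_lt (fun b => ((x b : ℕ) : ℤ)) (fun b : Box lam mu => (b.1.2 : ℤ))
        (by exact_mod_cast hlt) (by exact_mod_cast hbc)
    · have h := hviol (not_lt.1 hlt)
      have hp : p (x b) = 0 := by
        have := h.2
        generalize p (x b) = z at this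
        revert z; decide
      rw [symVec_eq_zero p x b c hne hr h.1 hp]
      exact U.zero_mem

end Straightening

/-! ### From the symmetrizer to the integral coefficients -/

section Coefficients

variable {β : Type*} {ι : Type}
  {q q' : ℕ} {n : Fin q → ℕ} {n' : Fin q' → ℕ}
  (e : (Σ i : Fin q, Fin (n i)) ≃ β) (e' : (Σ i : Fin q', Fin (n' i)) ≃ β)
  (p : ι → ZMod 2)

theorem IsLineRestricted.comp {x : β → ι} {e : (Σ i : Fin q, Fin (n i)) ≃ β} {p : ι → ZMod 2}
    (hx : IsLineRestricted e p x) {g : Equiv.Perm β} (hg : g ∈ lineGroup e) :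
    IsLineRestricted e p (x ∘ g) := by
  intro b c hbc hxb hp
  exact g.injective (hx _ _ (by rw [hg, hg, hbc]) hxb hp)

theorem lineWord_comp_eq [LinearOrder ι] (x : β → ι) (g : Equiv.Perm β) (hg : g ∈ lineGroup e)
    (h1 : ∀ i, Monotone (lineWord e x i)) (h2 : ∀ i, Monotone (lineWord e (x ∘ g) i)) :
    x ∘ g = x := by
  ext1 b
  obtain ⟨⟨i, s⟩, rfl⟩ := e.surjective b
  obtain ⟨τ, hτ⟩ := (exists_lineGroup_iff e x (x ∘ g)).2 ⟨g, hg, rfl⟩ i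
  have h3 : lineWord e (x ∘ g) i = lineWord e x i ∘ τ := funext hτ
  have h4 := Tuple.unique_monotone (f := lineWord e x i) (σ := τ) (τ := Equiv.refl _)
    (h3 ▸ h2 i) (h1 i)
  rw [← h3] at h4
  exact congrFun h4 s

variable [Fintype β]

/-- A change of ranking alters the sign by a coboundary. It is needed because the group acts in the
row reading, whereas column monomials are multiplied in the column reading. -/
theorem permSign_eq_relSign_mul {f g : β → ℕ} (hf : f.Injective) (hg : g.Injective)
    (ε : β → ZMod 2) (w : Equiv.Perm β) :
    permSign f ε w = relSign f g ε * permSign g ε w * relSign f g (ε ∘ w) := by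
  have hfw := hf.comp w.symm.injective
  have hgw := hg.comp w.symm.injective
  have h := relSign_comp w (g ∘ w.symm) (f ∘ w.symm) ε
  have e1 : (f ∘ w.symm) ∘ w = f := by ext b; simp
  have e2 : (g ∘ w.symm) ∘ w = g := by ext b; simp
  rw [e1, e2, relSign_comm hf hg] at h
  unfold permSign
  rw [h, relSign_mul hf hg hgw, relSign_mul hf hgw hfw]

theorem fillingDelta_mul (x y : β → ι) (F : (β → ι) → ℤ) :
    fillingDelta x y * F y = fillingDelta x y * F x := by
  unfold fillingDelta
  split_ifs with h
  · rw [h]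
  · simp

/-- The number of permutations within the lines that preserve the filling. -/
noncomputable def stabilizerCard (x : β → ι) : ℤ := ∑ g : lineGroup e, fillingDelta (x ∘ g.1) x

theorem stabilizerCard_pos (x : β → ι) : 0 < stabilizerCard e x := by
  unfold stabilizerCard
  refine Finset.sum_pos' (fun g _ => ?_) ⟨1, Finset.mem_univ _, ?_⟩
  · unfold fillingDelta
    split_ifs <;> norm_num
  · rw [fillingDelta, if_pos]
    · norm_num
    · rfl

theorem sum_fillingDelta_left (x : β → ι) (g : Equiv.Perm β) (hg : g ∈ lineGroup e) :
    ∑ r : lineGroup e, fillingDelta (x ∘ r.1) (x ∘ g) = stabilizerCard e x := by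
  unfold stabilizerCard
  refine (Equiv.sum_comp (Equiv.mulRight (⟨g, hg⟩ : lineGroup e)) _).symm.trans ?_
  refine Finset.sum_congr rfl fun r _ => ?_
  unfold fillingDelta
  congr 1
  simp only [Equiv.coe_mulRight, Subgroup.coe_mul, Equiv.Perm.coe_mul, ← Function.comp_assoc,
    eq_iff_iff]
  exact g.surjective.injective_comp_right.eq_iff

theorem sum_fillingDelta_right (x : β → ι) (g : Equiv.Perm β) (hg : g ∈ lineGroup e) :
    ∑ r : lineGroup e, fillingDelta ((x ∘ g) ∘ r.1) x = stabilizerCard e x := by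
  unfold stabilizerCard
  refine Eq.trans ?_ (Equiv.sum_comp (Equiv.mulLeft (⟨g, hg⟩ : lineGroup e)) _)
  rfl

variable [LinearOrder ι]

/-- Only odd letters repeat within a row, so the twisted sign of `r` depends only on `x ∘ r`, and
each rearrangement is reached as often as `x` is fixed. By `permSign_mul_permSign_one` this sign is
that of the divided power monomial in `ΠM`, up to shift signs. -/
theorem sum_twistSign (x y : β → ι) (hx : IsLineRestricted e (p + 1) x) :
    ∑ r : lineGroup e, fillingDelta (x ∘ r.1) y * twistSign e p x r.1 =
      stabilizerCard e x * shiftSign (lineRank e) (p ∘ x + 1) *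
        ((∏ i, dualCoeff (p + 1) (lineWord e x i) (lineWord e y i)) *
          shiftSign (lineRank e) (p ∘ y + 1)) := by
  by_cases hy : ∃ g ∈ lineGroup e, y = x ∘ g
  · obtain ⟨g, hg, rfl⟩ := hy
    rw [prod_dualCoeff_comp e _ x hx g hg, ← sum_fillingDelta_left e x g hg, Finset.sum_mul,
      Finset.sum_mul]
    refine Finset.sum_congr rfl fun r _ => ?_
    have h1 : twistSign e p x r.1 = lineSign e (p + 1) x * lineSign e (p + 1) (x ∘ r.1) *
        (shiftSign (lineRank e) (p ∘ x + 1) * shiftSign (lineRank e) (p ∘ (x ∘ r.1) + 1)) := by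
      rw [twistSign, permSign_mul_permSign_one (lineRank_injective e),
        ← permSign_lineGroup e (p + 1) x hx r.1 r.2]
      rfl
    rw [h1, ← fillingDelta_mul _ _ (fun z => lineSign e (p + 1) x * lineSign e (p + 1) z *
        (shiftSign (lineRank e) (p ∘ x + 1) * shiftSign (lineRank e) (p ∘ z + 1)))]
    ring
  · rw [prod_dualCoeff_eq_zero e _ x y hy]
    simp only [zero_mul, mul_zero]
    refine Finset.sum_eq_zero fun r _ => ?_
    rw [fillingDelta, if_neg, zero_mul]
    exact fun h => hy ⟨r.1, r.2, h.symm⟩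

/-- The column analogue of `sum_twistSign`, for the untwisted action. The two `relSign` factors
convert the row reading into the column reading. -/
theorem sum_permSign (x y : β → ι) (hy : IsLineRestricted e' p y) :
    ∑ c : lineGroup e', fillingDelta (x ∘ c.1) y * permSign (lineRank e) (p ∘ x) c.1 =
      stabilizerCard e' y * relSign (lineRank e) (lineRank e') (p ∘ y) *
        (relSign (lineRank e) (lineRank e') (p ∘ x) *
          ∏ j, dualCoeff p (lineWord e' y j) (lineWord e' x j)) := by
  by_cases hx : ∃ g ∈ lineGroup e', x = y ∘ g
  · obtain ⟨g, hg, rfl⟩ := hx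
    rw [prod_dualCoeff_comp e' _ y hy g hg, ← sum_fillingDelta_right e' y g hg, Finset.sum_mul,
      Finset.sum_mul]
    refine Finset.sum_congr rfl fun r _ => ?_
    have h1 : permSign (lineRank e) (p ∘ (y ∘ g)) r.1 =
        relSign (lineRank e) (lineRank e') (p ∘ (y ∘ g)) * (lineSign e' p (y ∘ g) *
        lineSign e' p ((y ∘ g) ∘ r.1)) * relSign (lineRank e) (lineRank e') (p ∘ ((y ∘ g) ∘ r.1)) := by
      rw [permSign_eq_relSign_mul (lineRank_injective e) (lineRank_injective e'),
        ← permSign_lineGroup e' p (y ∘ g) (hy.comp hg) r.1 r.2]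
      rfl
    rw [h1, ← fillingDelta_mul _ _ (fun z => relSign (lineRank e) (lineRank e') (p ∘ (y ∘ g)) *
        (lineSign e' p (y ∘ g) * lineSign e' p z) *
        relSign (lineRank e) (lineRank e') (p ∘ z))]
    ring
  · rw [prod_dualCoeff_eq_zero e' _ y x hx]
    simp only [mul_zero]
    refine Finset.sum_eq_zero fun r _ => ?_
    rw [fillingDelta, if_neg, zero_mul]
    intro h
    refine hx ⟨r.1⁻¹, inv_mem r.2, ?_⟩
    rw [← h, Function.comp_assoc, ← Equiv.Perm.coe_mul, mul_inv_cancel]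
    rfl

variable [DecidableEq β] [Fintype ι]

/-- The coefficient of the monomial of the column words of `s` in the image of the divided power
monomial of the row words of `x`. -/
noncomputable def thetaCoeff (x s : β → ι) : ℤ :=
  ∑ y : β → ι, ((∏ i, dualCoeff (p + 1) (lineWord e x i) (lineWord e y i)) *
      shiftSign (lineRank e) (p ∘ y + 1)) *
    (relSign (lineRank e) (lineRank e') (p ∘ y) *
      ∏ j, dualCoeff p (lineWord e' s j) (lineWord e' y j))

/-- Garnir relations are visible for the group sums, but stabilizer orders may vanish in `k`. This
factorization isolates them, so that they can be cancelled over `ℚ`. -/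
theorem symCoeff_eq_mul_thetaCoeff (x s : β → ι) (hx : IsLineRestricted e (p + 1) x)
    (hs : IsLineRestricted e' p s) :
    symCoeff e e' p x s =
      (stabilizerCard e x * shiftSign (lineRank e) (p ∘ x + 1)) *
      (stabilizerCard e' s * relSign (lineRank e) (lineRank e') (p ∘ s)) *
      thetaCoeff e e' p x s := by
  have h1 : symCoeff e e' p x s = ∑ y : β → ι,
      (∑ r : lineGroup e, fillingDelta (x ∘ r.1) y * twistSign e p x r.1) *
      ∑ c : lineGroup e', fillingDelta (y ∘ c.1) s * permSign (lineRank e) (p ∘ y) c.1 := by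
    simp only [Finset.sum_mul, mul_assoc]
    rw [Finset.sum_comm]
    unfold symCoeff
    refine Finset.sum_congr rfl fun r _ => ?_
    rw [Finset.sum_eq_single (x ∘ r.1)]
    · rw [fillingDelta, if_pos rfl, one_mul, Finset.mul_sum]
      refine Finset.sum_congr rfl fun c _ => ?_
      -- The factor `permSign (lineRank e) 1 c` in `symCoeff` cancels the twist of `c`, leaving the
      -- plain super action on columns.
      rw [twistSign_mul, Equiv.Perm.coe_mul, Function.comp_assoc]
      have := permSign_mul_self (lineRank e) 1 c.1
      calc _ = twistSign e p x r.1 * (fillingDelta (x ∘ r.1 ∘ c.1) s *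
            (permSign (lineRank e) (p ∘ (x ∘ r.1)) c.1 *
              (permSign (lineRank e) 1 c.1 * permSign (lineRank e) 1 c.1))) := by
            unfold twistSign; ring
        _ = _ := by rw [this, mul_one]
    · intro y _ hy
      rw [fillingDelta, if_neg (Ne.symm hy), zero_mul]
    · simp
  rw [h1, thetaCoeff, Finset.mul_sum]
  refine Finset.sum_congr rfl fun y _ => ?_
  rw [sum_twistSign e p x y hx, sum_permSign e e' p y s hs]
  ring

end Coefficients

/-! ### Unitriangularity and integral straightening -/

section Triangularity

variable {lam mu : YoungDiagram} {m : ℕ} {p : Fin m → ZMod 2}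

theorem IsCostandard.monotone_row {t : Tableau lam mu (Fin m)} (ht : IsCostandard p t)
    (i : Fin (lam.colLen 0)) : Monotone (lineWord (rowBox lam mu) t i) := by
  intro r s hrs
  rcases hrs.lt_or_eq with h | h
  · exact (ht.1 (rowBox lam mu ⟨i, r⟩) (rowBox lam mu ⟨i, s⟩) rfl (Nat.add_lt_add_left h _)).1
  · rw [h]

theorem IsCostandard.monotone_col {t : Tableau lam mu (Fin m)} (ht : IsCostandard p t)
    (j : Fin (lam.rowLen 0)) : Monotone (lineWord (colBox lam mu) t j) := by
  intro r s hrs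
  rcases hrs.lt_or_eq with h | h
  · exact (ht.2 (colBox lam mu ⟨j, r⟩) (colBox lam mu ⟨j, s⟩) rfl (Nat.add_lt_add_left h _)).1
  · rw [h]

theorem IsCostandard.restricted_row {t : Tableau lam mu (Fin m)} (ht : IsCostandard p t) :
    IsLineRestricted (rowBox lam mu) (p + 1) t := by
  intro b c hbc hx hp
  have hrow : b.1.1 = c.1.1 := congrArg Fin.val hbc
  have hp' : p (t b) ≠ 1 := by
    simp only [Pi.add_apply, Pi.one_apply] at hp
    generalize p (t b) = z at hp
    revert z; decide
  rcases lt_trichotomy b.1.2 c.1.2 with h | h | h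
  · exact absurd ((ht.1 b c hrow h).2 hx) hp'
  · exact Subtype.ext (Prod.ext hrow h)
  · rw [hx] at hp'
    exact absurd ((ht.1 c b hrow.symm h).2 hx.symm) hp'

theorem IsCostandard.restricted_col {t : Tableau lam mu (Fin m)} (ht : IsCostandard p t) :
    IsLineRestricted (colBox lam mu) p t := by
  intro b c hbc hx hp
  have hcol : b.1.2 = c.1.2 := congrArg Fin.val hbc
  rcases lt_trichotomy b.1.1 c.1.1 with h | h | h
  · exact absurd (((ht.2 b c hcol h).2 hx).symm.trans hp) (by decide)
  · exact Subtype.ext (Prod.ext h hcol)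
  · rw [hx] at hp
    exact absurd (((ht.2 c b hcol.symm h).2 hx.symm).symm.trans hp) (by decide)

/-- This is the rearrangement inequality. Adding multiples of the row number to entries and column
numbers makes `f` and `g` increase together over the whole diagram; as `r` preserves rows, these
additions cancel and the column weights are compared. Equality forces the rows of `t ∘ r` to be
sorted, so that `t ∘ r = t`. -/
theorem IsCostandard.colWeight_comp_lt {t : Tableau lam mu (Fin m)} (ht : IsCostandard p t)
    (r : Equiv.Perm (Box lam mu)) (hr : r ∈ lineGroup (rowBox lam mu)) :
    t ∘ r = t ∨ colWeight (t ∘ r) < colWeight t := by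
  let L : ℤ := lam.rowLen 0
  let f : Box lam mu → ℤ := fun b => ((t b : ℕ) : ℤ) + m * b.1.1
  let g : Box lam mu → ℤ := fun b => (b.1.2 : ℤ) + L * b.1.1
  have hcol : ∀ b : Box lam mu, (b.1.2 : ℤ) < L := by
    intro b
    have h1 := YoungDiagram.mem_iff_lt_rowLen.1 (lam.up_left_mem (Nat.zero_le b.1.1) le_rfl b.2.1)
    exact Int.ofNat_lt.2 h1
  have hL : 0 ≤ L := Int.natCast_nonneg _
  have hrowlt : ∀ b c : Box lam mu, b.1.1 < c.1.1 → g b < g c ∧ f b ≤ f c := by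
    intro b c h
    have h1 : ((b.1.1 : ℕ) : ℤ) + 1 ≤ c.1.1 := by exact_mod_cast h
    have h2 := hcol b
    have h3 : (((t b : Fin m) : ℕ) : ℤ) < m := by exact_mod_cast (t b).2
    have h4 : (0 : ℤ) ≤ c.1.2 := Int.natCast_nonneg _
    have h5 : (0 : ℤ) ≤ ((t c : Fin m) : ℕ) := Int.natCast_nonneg _
    constructor
    · simp only [g]
      nlinarith
    · simp only [f]
      nlinarith
  have hmono : Monovary f g := by
    intro b c hbc
    rcases lt_trichotomy b.1.1 c.1.1 with h | h | h
    · exact (hrowlt b c h).2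
    · have h1 : b.1.2 < c.1.2 := by
        simp only [g, h] at hbc
        omega
      have h2 := (ht.1 b c h h1).1
      rw [Fin.le_def] at h2
      simp only [f, h]
      omega
    · exact absurd hbc (hrowlt c b h).1.not_gt
  have hr' := (mem_lineGroup_rowBox r).1 hr
  have hsum1 : ∀ x : Tableau lam mu (Fin m),
      ∑ b, (((x b : ℕ) : ℤ) + m * b.1.1) * g b =
        colWeight x + L * rowWeight x + ∑ b : Box lam mu, (m : ℤ) * b.1.1 * g b := by
    intro x
    unfold colWeight rowWeight
    rw [Finset.mul_sum, ← Finset.sum_add_distrib, ← Finset.sum_add_distrib]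
    refine Finset.sum_congr rfl fun b _ => ?_
    simp only [g]
    ring
  have hfr : ∀ b, f (r b) = (((t ∘ r) b : ℕ) : ℤ) + m * b.1.1 := by
    intro b
    simp only [f, hr', Function.comp]
  have hle := hmono.sum_comp_perm_mul_le_sum_mul (σ := r)
  have heq := hmono.sum_comp_perm_mul_eq_sum_mul_iff (σ := r)
  simp only [hfr] at hle heq
  rw [hsum1, hsum1 t, rowWeight_comp t r hr] at hle heq
  rcases lt_or_ge (colWeight (t ∘ r)) (colWeight t) with h | h
  · exact Or.inr h
  · refine Or.inl (lineWord_comp_eq (rowBox lam mu) t r hr ht.monotone_row fun i a b hab => ?_)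
    have h1 := heq.1 (by omega)
    rcases hab.lt_or_eq with h2 | h2
    · have h3 : g (rowBox lam mu ⟨i, a⟩) < g (rowBox lam mu ⟨i, b⟩) := by
        have : mu.rowLen i + (a : ℕ) < mu.rowLen i + b := Nat.add_lt_add_left h2 _
        have : ((mu.rowLen i + (a : ℕ) : ℕ) : ℤ) < ((mu.rowLen i + b : ℕ) : ℤ) := by
          exact_mod_cast this
        exact add_lt_add_left this _
      have h4 := h1 h3
      simp only [Function.comp] at h4
      rw [hfr, hfr] at h4
      rw [Fin.le_def]
      have h5 : (((t ∘ r) (rowBox lam mu ⟨i, a⟩) : ℕ) : ℤ) ≤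
          ((t ∘ r) (rowBox lam mu ⟨i, b⟩) : ℕ) := le_of_add_le_add_right h4
      exact_mod_cast h5
    · rw [h2]

variable (p)

/-- The coefficients of `θ̂` for the shape `lam/mu`. -/
noncomputable abbrev boxCoeff (x s : Tableau lam mu (Fin m)) : ℤ :=
  thetaCoeff (rowBox lam mu) (colBox lam mu) p x s

variable {p}

/-- A nonzero term comes from some `y` that rearranges `t` within rows and `s` within columns. Then
`y` has the column weight of `s`, which is below that of `t` unless `y = t`; in that case `s` and
`t` are both column-sorted forms of `y`. -/
theorem boxCoeff_triangular {t s : Tableau lam mu (Fin m)} (ht : IsCostandard p t)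
    (hs : IsCostandard p s) (h : boxCoeff p t s ≠ 0) : s = t ∨ colWeight s < colWeight t := by
  obtain ⟨y, -, hy⟩ := Finset.exists_ne_zero_of_sum_ne_zero h
  have h1 : ∃ g ∈ lineGroup (rowBox lam mu), y = t ∘ g := by
    by_contra hc
    rw [prod_dualCoeff_eq_zero _ _ _ _ hc] at hy
    simp at hy
  have h2 : ∃ g ∈ lineGroup (colBox lam mu), y = s ∘ g := by
    by_contra hc
    rw [prod_dualCoeff_eq_zero _ _ _ _ hc] at hy
    simp at hy
  obtain ⟨r, hr, rfl⟩ := h1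
  obtain ⟨c, hc, hrc⟩ := h2
  have h3 := colWeight_comp s c hc
  rw [← hrc] at h3
  rcases ht.colWeight_comp_lt r hr with h4 | h4
  · left
    rw [h4] at hrc
    rw [hrc]
    exact (lineWord_comp_eq (colBox lam mu) s c hc hs.monotone_col
      (fun j => hrc ▸ ht.monotone_col j)).symm
  · right
    rw [← h3]
    exact h4

/-- By the same weight comparison only `y = t` contributes, and its term is a product of signs. -/
theorem boxCoeff_self_mul_self {t : Tableau lam mu (Fin m)} (ht : IsCostandard p t) :
    boxCoeff p t t * boxCoeff p t t = 1 := by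
  have h1 : boxCoeff p t t = shiftSign (lineRank (rowBox lam mu)) (p ∘ t + 1) *
      relSign (lineRank (rowBox lam mu)) (lineRank (colBox lam mu)) (p ∘ t) := by
    unfold boxCoeff thetaCoeff
    rw [Finset.sum_eq_single t]
    · have h2 := prod_dualCoeff_comp (rowBox lam mu) (p + 1) t ht.restricted_row 1 (one_mem _)
      have h3 := prod_dualCoeff_comp (colBox lam mu) p t ht.restricted_col 1 (one_mem _)
      simp only [Equiv.Perm.coe_one, Function.comp_id, lineSign_mul_self] at h2 h3
      rw [h2, h3, one_mul, mul_one]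
    · intro y _ hy
      by_cases hr : ∃ g ∈ lineGroup (rowBox lam mu), y = t ∘ g
      · by_cases hc : ∃ g ∈ lineGroup (colBox lam mu), y = t ∘ g
        · obtain ⟨r, hr, rfl⟩ := hr
          obtain ⟨c, hc, hrc⟩ := hc
          rcases ht.colWeight_comp_lt r hr with h4 | h4
          · exact absurd h4 hy
          · rw [hrc, colWeight_comp t c hc] at h4
            exact absurd h4 (lt_irrefl _)
        · rw [prod_dualCoeff_eq_zero _ _ _ _ hc]
          simp
      · rw [prod_dualCoeff_eq_zero _ _ _ _ hr]
        simp
    · simp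
  rw [h1, mul_mul_mul_comm, shiftSign_mul_self, relSign_mul_self, one_mul]

/-- The solutions of a unitriangular system of integral equations lie in the subgroup containing
the right hand sides. -/
theorem mem_of_triangular {τ K : Type*} [Fintype τ] [AddCommGroup K] (S : AddSubgroup K)
    (A : τ → τ → ℤ) (wt : τ → ℤ) (hdiag : ∀ t, A t t * A t t = 1)
    (hA : ∀ t s, A t s ≠ 0 → s = t ∨ wt s < wt t) (c : τ → K)
    (hc : ∀ s, ∑ t, A t s • c t ∈ S) (s : τ) : c s ∈ S := by
  classical
  -- Besides `c s`, the equation of index `s` involves only `c t` with `wt s < wt t`, so the system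
  -- is solved from the largest weight downwards.
  have hwf : WellFounded fun t s : τ => wt s < wt t := by
    have : IsTrans τ (fun t s : τ => wt s < wt t) := ⟨fun a b c h1 h2 => h2.trans h1⟩
    have : Std.Irrefl (fun t s : τ => wt s < wt t) := ⟨fun a h => lt_irrefl _ h⟩
    exact Finite.wellFounded_of_trans_of_irrefl _
  induction s using hwf.induction with
  | _ s ih =>
  have h1 := hc s
  rw [← Finset.add_sum_erase _ _ (Finset.mem_univ s)] at h1
  have h2 : ∑ t ∈ Finset.univ.erase s, A t s • c t ∈ S := by
    refine S.sum_mem fun t ht => ?_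
    by_cases h0 : A t s = 0
    · rw [h0, zero_smul]
      exact S.zero_mem
    · exact S.zsmul_mem (ih t ((hA t s h0).resolve_left (Finset.ne_of_mem_erase ht).symm)) _
  have h3 := S.zsmul_mem ((S.add_mem_cancel_right h2).1 h1) (A s s)
  rwa [smul_smul, hdiag, one_smul] at h3

open Classical in
/-- The straightening law over the integers. -/
theorem exists_boxCoeff_eq_sum (x : Tableau lam mu (Fin m))
    (hx : IsLineRestricted (rowBox lam mu) (p + 1) x) :
    ∃ c : {t : Tableau lam mu (Fin m) // IsCostandard p t} → ℤ,
      ∀ s, IsLineRestricted (colBox lam mu) p s →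
        boxCoeff p x s = ∑ t, c t * boxCoeff p t.1 s := by
  obtain ⟨d, hd⟩ := (Submodule.mem_span_range_iff_exists_fun ℚ).1 (symVec_mem_span p x)
  let a : Tableau lam mu (Fin m) → ℤ := fun y => stabilizerCard (rowBox lam mu) y *
    shiftSign (lineRank (rowBox lam mu)) (p ∘ y + 1)
  let b : Tableau lam mu (Fin m) → ℤ := fun y => stabilizerCard (colBox lam mu) y *
    relSign (lineRank (rowBox lam mu)) (lineRank (colBox lam mu)) (p ∘ y)
  have ha : ∀ y, (a y : ℚ) ≠ 0 := fun y => Int.cast_ne_zero.2 (mul_ne_zero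
    (stabilizerCard_pos _ y).ne' (left_ne_zero_of_mul_eq_one (shiftSign_mul_self _ _)))
  have hb : ∀ y, (b y : ℚ) ≠ 0 := fun y => Int.cast_ne_zero.2 (mul_ne_zero
    (stabilizerCard_pos _ y).ne' (left_ne_zero_of_mul_eq_one (relSign_mul_self _ _ _)))
  have hsym : ∀ y s, IsLineRestricted (rowBox lam mu) (p + 1) y →
      IsLineRestricted (colBox lam mu) p s →
      symVec p y s = (a y : ℚ) * b s * boxCoeff p y s := by
    intro y s hy hs
    rw [symVec, symCoeff_eq_mul_thetaCoeff _ _ p y s hy hs]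
    push_cast [a, b]
    rfl
  let c : {t : Tableau lam mu (Fin m) // IsCostandard p t} → ℚ := fun t => d t * a t.1 / a x
  have hc : ∀ s, IsLineRestricted (colBox lam mu) p s →
      (boxCoeff p x s : ℚ) = ∑ t, boxCoeff p t.1 s • c t := by
    intro s hs
    have h1 := congrFun hd s
    rw [Finset.sum_apply, hsym x s hx hs] at h1
    apply mul_left_cancel₀ (mul_ne_zero (ha x) (hb s))
    rw [← h1, Finset.mul_sum]
    refine Finset.sum_congr rfl fun t _ => ?_
    rw [Pi.smul_apply, hsym t.1 s t.2.restricted_row hs, zsmul_eq_mul, smul_eq_mul]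
    simp only [c]
    field_simp [ha x]
  -- With the integers as subgroup of `ℚ`: evaluating at costandard `s` gives a unitriangular system
  -- with integral right hand sides, so the rational coefficients `c` are integers.
  have hint := mem_of_triangular (Int.castAddHom ℚ).range
    (fun t s : {t : Tableau lam mu (Fin m) // IsCostandard p t} => boxCoeff p t.1 s.1)
    (fun t => colWeight t.1) (fun t => boxCoeff_self_mul_self t.2)
    (fun t s h => (boxCoeff_triangular t.2 s.2 h).imp_left Subtype.ext) c
    (fun s => ⟨boxCoeff p x s.1, hc s.1 s.2.restricted_col⟩)
  choose c' hc' using hint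
  refine ⟨c', fun s hs => ?_⟩
  have h := hc s hs
  simp only [← hc', zsmul_eq_mul, Int.coe_castAddHom] at h
  rw [← Int.cast_inj (α := ℚ), h]
  push_cast
  exact Finset.sum_congr rfl fun t _ => mul_comm _ _

end Triangularity

/-! ### Monomial bases of symmetric and divided powers -/

section SymPowBasis

variable {k : Type u} [Field k] {M : Type v} [AddCommGroup M] [Module k M] {m : ℕ}

/-- Nondecreasing words in which no odd letter is repeated. -/
abbrev SortedWord (p : Fin m → ZMod 2) (d : ℕ) : Type :=
  {w : Fin d → Fin m // Monotone w ∧ IsRestricted p w}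

noncomputable instance sortedWordFintype (p : Fin m → ZMod 2) (d : ℕ) :
    Fintype (SortedWord p d) := Fintype.ofFinite _

/-- The monomial of a word in a symmetric power. -/
noncomputable def symMonomial (G : ZMod 2 → Submodule k M) (b : Module.Basis (Fin m) k M) {d : ℕ}
    (x : Fin d → Fin m) : SymPow G d :=
  symMul G d (PiTensorProduct.tprod k fun s => b (x s))

/-- The functional on `M^{⊗ d}` with value `dualCoeff p i j` at the basis tensor of the word `j`. -/
noncomputable def wordFunctional (b : Module.Basis (Fin m) k M) (p : Fin m → ZMod 2) {d : ℕ}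
    (i : Fin d → Fin m) : (⨂[k]^d M) →ₗ[k] k :=
  ∑ j : Fin d → Fin m, (dualCoeff p i j : k) • PiTensorProduct.lift
    ((MultilinearMap.mkPiAlgebra k (Fin d) k).compLinearMap (fun s => b.coord (j s)))

theorem wordFunctional_tprod (b : Module.Basis (Fin m) k M) (p : Fin m → ZMod 2) {d : ℕ}
    (i : Fin d → Fin m) (v : Fin d → M) :
    wordFunctional b p i (PiTensorProduct.tprod k v) =
      ∑ j : Fin d → Fin m, (dualCoeff p i j : k) * ∏ s, b.coord (j s) (v s) := by
  simp [wordFunctional]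

theorem wordFunctional_basis (b : Module.Basis (Fin m) k M) (p : Fin m → ZMod 2) {d : ℕ}
    (i j : Fin d → Fin m) :
    wordFunctional b p i (PiTensorProduct.tprod k fun s => b (j s)) = dualCoeff p i j := by
  rw [wordFunctional_tprod, Finset.sum_eq_single j]
  · simp
  · intro l _ hl
    obtain ⟨s, hs⟩ := Function.ne_iff.1 hl
    rw [Finset.prod_eq_zero (Finset.mem_univ s), mul_zero]
    simp [Ne.symm hs]
  · simp

variable (G : ZMod 2 → Submodule k M) (b : Module.Basis (Fin m) k M) (p : Fin m → ZMod 2)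

/-- Under adjacent swaps `dualCoeff` changes by the sign in the defining relations. The functionals
therefore descend to the symmetric power, where they separate the sorted monomials. -/
theorem symRel_le_ker_wordFunctional
    (hG : ∀ ε, ∀ v ∈ G ε, ∀ j, p j ≠ ε → b.coord j v = 0) {d : ℕ} (i : Fin d → Fin m) :
    symRel G d ≤ LinearMap.ker (wordFunctional b p i) := by
  refine Submodule.span_le.2 ?_
  rintro x ⟨v, s, t, α, β, hst, hs, ht, rfl⟩
  simp only [SetLike.mem_coe, LinearMap.mem_ker, map_sub, map_smul, wordFunctional_tprod]
  have h1 : ∑ j : Fin d → Fin m,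
      (dualCoeff p i j : k) * ∏ r, b.coord (j r) (v (Equiv.swap s t r)) =
      ∑ j : Fin d → Fin m, (dualCoeff p i (fun r => j (Equiv.swap s t r)) : k) *
        ∏ r, b.coord (j r) (v r) := by
    rw [← Equiv.sum_comp (Equiv.arrowCongr (Equiv.swap s t) (Equiv.refl (Fin m)))]
    refine Finset.sum_congr rfl fun j _ => ?_
    congr 1
    rw [← Equiv.prod_comp (Equiv.swap s t)]
    simp
  rw [h1, sub_eq_zero, smul_eq_mul, Finset.mul_sum]
  refine Finset.sum_congr rfl fun j _ => ?_
  by_cases hα : p (j s) = α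
  · by_cases hβ : p (j t) = β
    · rw [dualCoeff_swap p i j s t hst, hα, hβ, ← mul_assoc, ← Int.cast_mul, ← mul_assoc,
        koszul_mul_self, one_mul]
    · rw [Finset.prod_eq_zero (Finset.mem_univ t) (hG _ _ ht _ hβ)]
      simp
  · rw [Finset.prod_eq_zero (Finset.mem_univ s) (hG _ _ hs _ hα)]
    simp

theorem dualCoeff_of_monotone {d : ℕ} (i j : Fin d → Fin m) (hi : Monotone i) (hj : Monotone j)
    (hri : IsRestricted p i) : dualCoeff p i j = if j = i then 1 else 0 := by
  split_ifs with h
  · subst h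
    rw [dualCoeff, if_pos ⟨hri, Equiv.refl _, fun _ => rfl⟩, wordSign_mul_self]
  · rw [dualCoeff, if_neg]
    rintro ⟨-, τ, hτ⟩
    have h1 : j = i ∘ τ := funext hτ
    exact h (h1.trans (Tuple.unique_monotone (f := i) (σ := τ) (τ := Equiv.refl _) (h1 ▸ hj) hi))

variable {G b p}

theorem symMonomial_swap (hb : ∀ j, b j ∈ G (p j)) {d : ℕ} (x : Fin d → Fin m) (s t : Fin d)
    (hst : (s : ℕ) + 1 = t) :
    symMonomial G b x =
      (koszul (p (x s)) (p (x t)) : k) • symMonomial G b fun r => x (Equiv.swap s t r) := by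
  unfold symMonomial
  rw [← map_smul, ← sub_eq_zero, ← map_sub]
  exact (Submodule.Quotient.mk_eq_zero _).2
    (Submodule.subset_span ⟨_, s, t, _, _, hst, hb _, hb _, rfl⟩)

/-- Swapping two equal odd neighbours shows that the monomial is its own negative; here
characteristic 2 must be excluded. -/
theorem symMonomial_eq_zero (hk : (2 : k) ≠ 0) (hb : ∀ j, b j ∈ G (p j)) {d : ℕ}
    (x : Fin d → Fin m) (s t : Fin d) (hst : (s : ℕ) + 1 = t) (hx : x s = x t)
    (hp : p (x s) = 1) : symMonomial G b x = 0 := by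
  have h := symMonomial_swap hb x s t hst
  have h1 : (fun r => x (Equiv.swap s t r)) = x := by
    ext1 r
    rw [Equiv.swap_apply_def]
    split_ifs with h1 h2
    · rw [h1, hx]
    · rw [h2, hx]
    · rfl
  rw [h1, ← hx, hp, koszul_one_one] at h
  have h2 : (2 : k) • symMonomial G b x = 0 := by
    rw [two_smul]
    nth_rewrite 1 [h]
    simp
  exact (smul_eq_zero.1 h2).resolve_left hk

/-- Sorting by adjacent swaps raises the weight `wt`, and both sides acquire the same sign at each
swap. For a sorted word with a repeated odd letter both sides vanish. -/
theorem symMonomial_eq_sum (hk : (2 : k) ≠ 0) (hb : ∀ j, b j ∈ G (p j)) {d : ℕ}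
    (x : Fin d → Fin m) :
    symMonomial G b x = ∑ w : SortedWord p d, (dualCoeff p w.1 x : k) • symMonomial G b w.1 := by
  classical
  let wt : (Fin d → Fin m) → ℤ := fun x => ∑ s, ((x s : ℕ) : ℤ) * ((s : ℕ) : ℤ)
  have hwf : WellFounded fun y x : Fin d → Fin m => wt x < wt y := by
    have : IsTrans _ (fun y x : Fin d → Fin m => wt x < wt y) := ⟨fun a b c h1 h2 => h2.trans h1⟩
    have : Std.Irrefl (fun y x : Fin d → Fin m => wt x < wt y) := ⟨fun a h => lt_irrefl _ h⟩
    exact Finite.wellFounded_of_trans_of_irrefl _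
  induction x using hwf.induction with
  | _ x ih =>
  by_cases hx : Monotone x
  · by_cases hr : IsRestricted p x
    · rw [Finset.sum_eq_single ⟨x, hx, hr⟩]
      · rw [dualCoeff_of_monotone p _ _ hx hx hr]
        simp
      · intro w _ hw
        rw [dualCoeff_of_monotone p _ _ w.2.1 hx w.2.2, if_neg, Int.cast_zero, zero_smul]
        exact fun h => hw (Subtype.ext h.symm)
      · simp
    · have hzero : symMonomial G b x = 0 := by
        have hadj : ∀ s t : Fin d, s < t → x s = x t → p (x s) = 1 → symMonomial G b x = 0 := by
          intro s t hst hxs hp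
          -- A sorted word is constant between two equal letters, so the repetition already occurs
          -- at neighbouring positions.
          let s' : Fin d := ⟨s + 1, lt_of_le_of_lt (Nat.succ_le_of_lt hst) t.2⟩
          refine symMonomial_eq_zero hk hb x s s' rfl (le_antisymm (hx ?_) ?_) hp
          · exact Fin.le_def.2 (Nat.le_succ _)
          · rw [hxs]
            exact hx (Fin.le_def.2 (Nat.succ_le_of_lt hst))
        unfold IsRestricted at hr
        push Not at hr
        obtain ⟨s, t, hxs, hp, hne⟩ := hr
        rcases lt_or_gt_of_ne hne with h | h
        · exact hadj s t h hxs hp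
        · exact hadj t s h hxs.symm (hxs ▸ hp)
      rw [hzero]
      refine (Finset.sum_eq_zero fun w _ => ?_).symm
      rw [dualCoeff, if_neg, Int.cast_zero, zero_smul]
      rintro ⟨hw, τ, hτ⟩
      refine hr fun s t hst hp => τ.injective (hw _ _ ?_ ?_)
      · rw [← hτ, ← hτ, hst]
      · rw [← hτ, hp]
  · obtain ⟨s, t, hst, hlt⟩ : ∃ s t : Fin d, (s : ℕ) + 1 = t ∧ x t < x s := by
      cases d with
      | zero => exact absurd (fun a => a.elim0) hx
      | succ d =>
        rw [Fin.monotone_iff_le_succ] at hx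
        push Not at hx
        obtain ⟨i, hi⟩ := hx
        exact ⟨i.castSucc, i.succ, by simp, hi⟩
    have hwt : wt x < wt fun r => x (Equiv.swap s t r) := by
      refine sum_swap_lt (fun r => ((x r : ℕ) : ℤ)) (fun r => ((r : ℕ) : ℤ)) ?_ ?_
      · exact_mod_cast hlt
      · exact_mod_cast (by omega : (s : ℕ) < t)
    rw [symMonomial_swap hb x s t hst, ih _ hwt, Finset.smul_sum]
    refine Finset.sum_congr rfl fun w _ => ?_
    rw [dualCoeff_swap p w.1 x s t hst, smul_smul, ← Int.cast_mul, ← mul_assoc, koszul_mul_self,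
      one_mul]

/-- The basis of the symmetric power formed by the monomials of the sorted words. -/
noncomputable def symBasis (hk : (2 : k) ≠ 0) (hb : ∀ j, b j ∈ G (p j))
    (hG : ∀ ε, ∀ v ∈ G ε, ∀ j, p j ≠ ε → b.coord j v = 0) (d : ℕ) :
    Module.Basis (SortedWord p d) k (SymPow G d) :=
  Module.Basis.mk (v := fun w : SortedWord p d => symMonomial G b w.1)
    (by
      rw [Fintype.linearIndependent_iff]
      intro g hg w
      have h := congrArg (symLift G d (wordFunctional b p w.1)
        (symRel_le_ker_wordFunctional G b p hG w.1)) hg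
      rw [map_sum, map_zero, Finset.sum_eq_single w] at h
      · rw [map_smul, symMonomial, symLift_symMul, wordFunctional_basis,
          dualCoeff_of_monotone p _ _ w.2.1 w.2.1 w.2.2] at h
        simpa using h
      · intro w' _ hw'
        rw [map_smul, symMonomial, symLift_symMul, wordFunctional_basis,
          dualCoeff_of_monotone p _ _ w.2.1 w'.2.1 w.2.2, if_neg fun h => hw' (Subtype.ext h)]
        simp
      · simp)
    (by
      rintro y -
      have hsurj : Function.Surjective (symMul G d) := (symRel G d).mkQ_surjective
      obtain ⟨z, rfl⟩ := hsurj y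
      have hz : z ∈ Submodule.span k
          (Set.range (Basis.piTensorProduct (fun _ : Fin d => b))) := by
        rw [Module.Basis.span_eq]
        trivial
      induction hz using Submodule.span_induction with
      | mem z hz =>
        obtain ⟨x, rfl⟩ := hz
        rw [Basis.piTensorProduct_apply]
        rw [show symMul G d (PiTensorProduct.tprod k fun s => b (x s)) = symMonomial G b x from rfl,
          symMonomial_eq_sum hk hb x]
        exact Submodule.sum_mem _ fun w _ => Submodule.smul_mem _ _ (Submodule.subset_span ⟨w, rfl⟩)
      | zero => rw [map_zero]; exact Submodule.zero_mem _
      | add y z _ _ hy hz => rw [map_add]; exact Submodule.add_mem _ hy hz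
      | smul c z _ hz => rw [map_smul]; exact Submodule.smul_mem _ _ hz)

theorem symBasis_apply (hk : (2 : k) ≠ 0) (hb : ∀ j, b j ∈ G (p j))
    (hG : ∀ ε, ∀ v ∈ G ε, ∀ j, p j ≠ ε → b.coord j v = 0) (d : ℕ) (w : SortedWord p d) :
    symBasis hk hb hG d w = symMonomial G b w.1 := by
  simp [symBasis]

theorem symBasis_repr (hk : (2 : k) ≠ 0) (hb : ∀ j, b j ∈ G (p j))
    (hG : ∀ ε, ∀ v ∈ G ε, ∀ j, p j ≠ ε → b.coord j v = 0) (d : ℕ) (x : Fin d → Fin m)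
    (w : SortedWord p d) :
    (symBasis hk hb hG d).repr (symMonomial G b x) w = dualCoeff p w.1 x := by
  rw [symMonomial_eq_sum hk hb x]
  simp only [← symBasis_apply hk hb hG]
  rw [Module.Basis.repr_sum_self]

theorem coord_eq_zero_of_mem [DirectSum.Decomposition G] (hb : ∀ j, b j ∈ G (p j)) (ε : ZMod 2)
    (v : M) (hv : v ∈ G ε) (j : Fin m) (hj : p j ≠ ε) : b.coord j v = 0 := by
  have h1 : superProj G ε v = v := by rw [superProj_of_mem G ε hv, if_pos rfl]
  have h2 : superProj G ε v = ∑ i, (if ε = p i then b.coord i v else 0) • b i := by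
    conv_lhs => rw [← b.sum_repr v]
    rw [map_sum]
    refine Finset.sum_congr rfl fun i _ => ?_
    rw [map_smul, superProj_of_mem G ε (hb i)]
    split_ifs <;> simp
  rw [← h1, h2, Module.Basis.coord_apply, Module.Basis.repr_sum_self, if_neg (Ne.symm hj)]

theorem dualBasis_mem_dualGrading (hG : ∀ ε, ∀ v ∈ G ε, ∀ j, p j ≠ ε → b.coord j v = 0)
    (j : Fin m) : b.dualBasis j ∈ dualGrading G (p j) := by
  intro δ hδ v hv
  rw [Module.Basis.coe_dualBasis]
  exact hG δ v hv j hδ.symm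

theorem dualBasis_coord_eq_zero (hb : ∀ j, b j ∈ G (p j)) (ε : ZMod 2) (f : Module.Dual k M)
    (hf : f ∈ dualGrading G ε) (j : Fin m) (hj : p j ≠ ε) : b.dualBasis.coord j f = 0 := by
  rw [Module.Basis.coord_apply, Module.Basis.dualBasis_repr]
  exact hf _ hj _ (hb j)

/-- The basis of the divided power formed by the divided power monomials of the sorted words. -/
noncomputable def divBasis (hk : (2 : k) ≠ 0) (hb : ∀ j, b j ∈ G (p j))
    (hG : ∀ ε, ∀ v ∈ G ε, ∀ j, p j ≠ ε → b.coord j v = 0) (d : ℕ) :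
    Module.Basis (SortedWord p d) k (DivPow G d) :=
  (symBasis hk (dualBasis_mem_dualGrading hG) (dualBasis_coord_eq_zero hb) d).dualBasis

theorem divBasis_apply (hk : (2 : k) ≠ 0) (hb : ∀ j, b j ∈ G (p j))
    (hG : ∀ ε, ∀ v ∈ G ε, ∀ j, p j ≠ ε → b.coord j v = 0) (d : ℕ) (w : SortedWord p d) :
    divBasis hk hb hG d w = divMonomial G b p hb w.1 := by
  refine (symBasis hk (dualBasis_mem_dualGrading hG) (dualBasis_coord_eq_zero hb) d).ext
    fun x => ?_
  rw [divBasis, Module.Basis.dualBasis_apply_self, symBasis_apply, symMonomial,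
    Module.Basis.coe_dualBasis, divMonomial_dual G b p hb w.1 x.1 w.2.1 x.2.1 w.2.2]
  simp only [Subtype.ext_iff]

/-- The embedding is dual to multiplication, so the coefficients in the tensor power are the values
of the functional on words in the dual basis. -/
theorem divComul_divMonomial [Module.Finite k M] (hb : ∀ j, b j ∈ G (p j)) {d : ℕ}
    (i : Fin d → Fin m) :
    divComul G d (divMonomial G b p hb i) =
      ∑ x : Fin d → Fin m, (dualCoeff p i x : k) • PiTensorProduct.tprod k fun s => b (x s) := by
  rw [divComul, LinearMap.comp_apply, LinearEquiv.coe_coe, LinearEquiv.symm_apply_eq]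
  refine PiTensorProduct.ext (MultilinearMap.ext fun f => ?_)
  simp only [LinearMap.compMultilinearMap_apply, map_sum, map_smul, LinearMap.sum_apply,
    LinearMap.smul_apply, tensorEval_tprod, smul_eq_mul]
  exact dualFunctional_tprod b p i f

end SymPowBasis

/-! ### Concatenation of tensors and the two reading orders -/

section Concatenation

variable {k : Type u} [Field k] {M : Type v} [AddCommGroup M] [Module k M]

theorem concat_tprod {q : ℕ} (n : Fin q → ℕ) (v : (Σ i : Fin q, Fin (n i)) → M) :
    concat k M n (PiTensorProduct.tprod k fun i => PiTensorProduct.tprod k fun s => v ⟨i, s⟩) =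
      PiTensorProduct.tprod k fun t => v (finSigmaFinEquiv.symm t) := by
  rw [concat, LinearEquiv.trans_apply, ← tensorSigmaEquiv_tprod, LinearEquiv.symm_apply_apply,
    PiTensorProduct.reindex_tprod]

theorem concat_symm_tprod {q : ℕ} (n : Fin q → ℕ) (v : (Σ i : Fin q, Fin (n i)) → M) :
    (concat k M n).symm (PiTensorProduct.tprod k fun t => v (finSigmaFinEquiv.symm t)) =
      PiTensorProduct.tprod k fun i => PiTensorProduct.tprod k fun s => v ⟨i, s⟩ := by
  rw [LinearEquiv.symm_apply_eq, concat_tprod]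

end Concatenation

section Diagrams

variable {lam mu : YoungDiagram}

theorem lineRank_rowBox (b : Box lam mu) :
    lineRank (rowBox lam mu) b = (rowNumber lam mu b : ℕ) := rfl

theorem lineRank_colBox (b : Box lam mu) :
    lineRank (colBox lam mu) b = (colNumber lam mu b : ℕ) := rfl

theorem superSign_sigmaConj (ε : Box lam mu → ZMod 2) :
    superSign (ε ∘ (rowNumber lam mu).symm) (sigmaConj lam mu) =
      relSign (lineRank (rowBox lam mu)) (lineRank (colBox lam mu)) ε := by
  unfold superSign relSign
  rw [← Equiv.prod_comp (rowNumber lam mu)]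
  refine Finset.prod_congr rfl fun b _ => ?_
  rw [← Equiv.prod_comp (rowNumber lam mu)]
  refine Finset.prod_congr rfl fun c _ => ?_
  simp [sigmaConj, lineRank_rowBox, lineRank_colBox]

theorem prod_koszul_rowNumber (ε : Box lam mu → ZMod 2) :
    (∏ s, ∏ t, if s < t then koszul 1 (ε ((rowNumber lam mu).symm s)) else 1) =
      shiftSign (lineRank (rowBox lam mu)) ε := by
  unfold shiftSign
  rw [← Equiv.prod_comp (rowNumber lam mu)]
  refine Finset.prod_congr rfl fun b _ => ?_
  rw [← Equiv.prod_comp (rowNumber lam mu)]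
  refine Finset.prod_congr rfl fun c _ => ?_
  simp [lineRank_rowBox]

end Diagrams

/-! ### The matrix of the structure map, spanning and independence -/

section Theta

variable {k : Type u} [Field k] (M : Superspace.{u, v} k) {lam mu : YoungDiagram} {m : ℕ}
  (Z : Module.Basis (Fin m) k M.carrier) (p : Fin m → ZMod 2)

theorem deltaPi_gammaPiMonomial (hZ : ∀ i, Z i ∈ M.grading (p i))
    (x : Tableau lam mu (Fin m)) :
    deltaPi M lam mu (gammaPiMonomial Z p hZ x) =
      ∑ y : Tableau lam mu (Fin m),
        (((∏ i, dualCoeff (p + 1) (lineWord (rowBox lam mu) x i) (lineWord (rowBox lam mu) y i)) *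
          shiftSign (lineRank (rowBox lam mu)) (p ∘ y + 1) : ℤ) : k) •
        PiTensorProduct.tprod k fun s => Z (y ((rowNumber lam mu).symm s)) := by
  unfold deltaPi gammaPiMonomial
  simp only [LinearMap.comp_apply, PiTensorProduct.map_tprod, divComul_divMonomial,
    MultilinearMap.map_sum, MultilinearMap.map_smul_univ, map_sum, map_smul, LinearEquiv.coe_coe]
  let E : Tableau lam mu (Fin m) ≃ ((i : Fin (lam.colLen 0)) → Fin (skewRow lam mu i) → Fin m) :=
    (Equiv.arrowCongr (rowBox lam mu).symm (Equiv.refl (Fin m))).trans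
      (Equiv.piCurry fun _ _ => Fin m)
  rw [← Equiv.sum_comp E]
  refine Finset.sum_congr rfl fun y _ => ?_
  have hE : ∀ i s, E y i s = y (rowBox lam mu ⟨i, s⟩) := fun i s => rfl
  simp only [hE]
  rw [concat_tprod (skewRow lam mu) (fun z => Z (y (rowBox lam mu z))),
    shiftTensor_tprod M.grading _
      (fun t => p (y (rowBox lam mu (finSigmaFinEquiv.symm t))) + 1)
      (fun s => mem_parityShift Z p hZ _), smul_smul]
  have h := prod_koszul_rowNumber (p ∘ y + 1)
  rw [← h]
  simp only [Int.cast_mul, Int.cast_prod]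
  rfl

theorem mulConj_superPerm_tprod (hZ : ∀ i, Z i ∈ M.grading (p i))
    (y : Tableau lam mu (Fin m)) :
    mulConj M lam mu (superPerm M.grading (sigmaConj lam mu)
      (PiTensorProduct.tprod k fun s => Z (y ((rowNumber lam mu).symm s)))) =
      (relSign (lineRank (rowBox lam mu)) (lineRank (colBox lam mu)) (p ∘ y) : k) •
        PiTensorProduct.tprod k fun j =>
          symMonomial M.grading Z (lineWord (colBox lam mu) y j) := by
  rw [superPerm_tprod M.grading _ _ ((p ∘ y) ∘ (rowNumber lam mu).symm) (fun s => hZ _),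
    superSign_sigmaConj, map_smul]
  congr 1
  have h : (fun s => Z (y ((rowNumber lam mu).symm (sigmaConj lam mu s)))) =
      fun s => Z (y (colBox lam mu (finSigmaFinEquiv.symm s))) := by
    ext1 s
    simp [sigmaConj, colNumber]
  rw [h, mulConj, LinearMap.comp_apply, LinearEquiv.coe_coe,
    concat_symm_tprod (skewCol lam mu) (fun z => Z (y (colBox lam mu z))),
    PiTensorProduct.map_tprod]
  rfl

theorem thetaConj_gammaPiMonomial (hZ : ∀ i, Z i ∈ M.grading (p i))
    (x : Tableau lam mu (Fin m)) :
    thetaConj M lam mu (gammaPiMonomial Z p hZ x) =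
      ∑ y : Tableau lam mu (Fin m),
        (((∏ i, dualCoeff (p + 1) (lineWord (rowBox lam mu) x i) (lineWord (rowBox lam mu) y i)) *
          shiftSign (lineRank (rowBox lam mu)) (p ∘ y + 1) *
          relSign (lineRank (rowBox lam mu)) (lineRank (colBox lam mu)) (p ∘ y) : ℤ) : k) •
        PiTensorProduct.tprod k fun j =>
          symMonomial M.grading Z (lineWord (colBox lam mu) y j) := by
  rw [thetaConj, LinearMap.comp_apply, LinearMap.comp_apply, deltaPi_gammaPiMonomial, map_sum,
    map_sum]
  refine Finset.sum_congr rfl fun y _ => ?_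
  rw [map_smul, map_smul, mulConj_superPerm_tprod M Z p hZ, smul_smul, ← Int.cast_mul]

variable {M Z p}

/-- The basis of `S^{lam'/mu'}(M)` formed by the tensor products of monomials. -/
noncomputable def symConjBasis (hk : (2 : k) ≠ 0) (hZ : ∀ i, Z i ∈ M.grading (p i))
    (lam mu : YoungDiagram) :
    Module.Basis ((j : Fin (lam.rowLen 0)) → SortedWord p (skewCol lam mu j)) k
      (SymConj M lam mu) :=
  Basis.piTensorProduct fun j => symBasis hk hZ (coord_eq_zero_of_mem hZ) (skewCol lam mu j)

/-- The filling with given words in the lines. -/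
def fillWords {β : Type*} {q : ℕ} {n : Fin q → ℕ} (e : (Σ i : Fin q, Fin (n i)) ≃ β)
    (p : Fin m → ZMod 2) (w : (i : Fin q) → SortedWord p (n i)) : β → Fin m :=
  fun b => (w (e.symm b).1).1 (e.symm b).2

theorem lineWord_fillWords {β : Type*} {q : ℕ} {n : Fin q → ℕ}
    (e : (Σ i : Fin q, Fin (n i)) ≃ β) (w : (i : Fin q) → SortedWord p (n i)) (i : Fin q) :
    lineWord e (fillWords e p w) i = (w i).1 := by
  ext1 s
  have h : ∀ z : Σ i : Fin q, Fin (n i), z = ⟨i, s⟩ → (w z.1).1 z.2 = (w i).1 s := by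
    rintro _ rfl
    rfl
  exact h _ (e.symm_apply_apply _)

theorem isLineRestricted_fillWords {β : Type*} {q : ℕ} {n : Fin q → ℕ}
    (e : (Σ i : Fin q, Fin (n i)) ≃ β) (w : (i : Fin q) → SortedWord p (n i)) :
    IsLineRestricted e p (fillWords e p w) := by
  rw [isLineRestricted_iff]
  intro i
  rw [lineWord_fillWords]
  exact (w i).2.2

theorem exists_fillWords_eq {β : Type*} {q : ℕ} {n : Fin q → ℕ}
    (e : (Σ i : Fin q, Fin (n i)) ≃ β) (x : β → Fin m) (hx : IsLineRestricted e p x)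
    (hmono : ∀ i, Monotone (lineWord e x i)) :
    ∃ w : (i : Fin q) → SortedWord p (n i), fillWords e p w = x := by
  refine ⟨fun i => ⟨lineWord e x i, hmono i, (isLineRestricted_iff e p x).1 hx i⟩, ?_⟩
  ext1 b
  simp [fillWords, lineWord]

/-- The passage from `ℤ` to `k`: the coordinates of the images are reductions of integers, so
integral identities between rows of `boxCoeff` become linear relations over `k`. -/
theorem symConjBasis_repr_thetaConj (hk : (2 : k) ≠ 0) (hZ : ∀ i, Z i ∈ M.grading (p i))
    (x : Tableau lam mu (Fin m))
    (w : (j : Fin (lam.rowLen 0)) → SortedWord p (skewCol lam mu j)) :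
    (symConjBasis hk hZ lam mu).repr (thetaConj M lam mu (gammaPiMonomial Z p hZ x)) w =
      (boxCoeff p x (fillWords (colBox lam mu) p w) : k) := by
  rw [thetaConj_gammaPiMonomial, boxCoeff, thetaCoeff, map_sum, Finsupp.finsetSum_apply,
    Int.cast_sum]
  refine Finset.sum_congr rfl fun y _ => ?_
  rw [map_smul, Finsupp.smul_apply, symConjBasis, Basis.piTensorProduct_repr_tprod_apply]
  simp only [symBasis_repr, lineWord_fillWords]
  push_cast
  rw [smul_eq_mul]
  ring

/-- The images of the divided power monomials of row-sorted tableaux are integral combinations of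
those of the costandard tableaux. -/
theorem thetaConj_gammaPiMonomial_mem_span (hk : (2 : k) ≠ 0)
    (hZ : ∀ i, Z i ∈ M.grading (p i)) (x : Tableau lam mu (Fin m))
    (hx : IsLineRestricted (rowBox lam mu) (p + 1) x) :
    thetaConj M lam mu (gammaPiMonomial Z p hZ x) ∈ Submodule.span k
      (Set.range fun t : {t : Tableau lam mu (Fin m) // IsCostandard p t} =>
        thetaConj M lam mu (gammaPiMonomial Z p hZ t.1)) := by
  classical
  obtain ⟨c, hc⟩ := exists_boxCoeff_eq_sum x hx
  have h : thetaConj M lam mu (gammaPiMonomial Z p hZ x) =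
      ∑ t : {t : Tableau lam mu (Fin m) // IsCostandard p t}, (c t : k) •
        thetaConj M lam mu (gammaPiMonomial Z p hZ t.1) := by
    refine (symConjBasis hk hZ lam mu).ext_elem fun w => ?_
    rw [map_sum, Finsupp.finsetSum_apply, symConjBasis_repr_thetaConj,
      hc _ (isLineRestricted_fillWords _ w), Int.cast_sum]
    refine Finset.sum_congr rfl fun t _ => ?_
    rw [map_smul, Finsupp.smul_apply, symConjBasis_repr_thetaConj, Int.cast_mul, smul_eq_mul]
  rw [h]
  exact Submodule.sum_mem _ fun t _ => Submodule.smul_mem _ _ (Submodule.subset_span ⟨t, rfl⟩)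

theorem schurConj_le_span (hk : (2 : k) ≠ 0) (hZ : ∀ i, Z i ∈ M.grading (p i)) :
    schurConj M lam mu ≤ Submodule.span k
      (Set.range fun t : {t : Tableau lam mu (Fin m) // IsCostandard p t} =>
        thetaConj M lam mu (gammaPiMonomial Z p hZ t.1)) := by
  have hZ' := mem_parityShift Z p hZ
  have hG' : ∀ ε, ∀ v ∈ parityShift M.grading ε, ∀ j, p j + 1 ≠ ε → Z.coord j v = 0 := by
    intro ε v hv j hj
    refine coord_eq_zero_of_mem hZ (ε + 1) v hv j fun h => hj ?_
    rw [h, add_assoc]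
    exact add_zero ε
  -- The source is spanned by the monomials of fillings with sorted rows, restricted for the
  -- parities `p + 1` of `ΠM`, and each of these can be straightened.
  let B := Basis.piTensorProduct fun i : Fin (lam.colLen 0) =>
    divBasis (p := fun j => p j + 1) hk hZ' hG' (skewRow lam mu i)
  rw [schurConj, LinearMap.range_eq_map, ← B.span_eq, Submodule.map_span, Submodule.span_le]
  rintro _ ⟨_, ⟨w, rfl⟩, rfl⟩
  have h : B w = gammaPiMonomial Z p hZ (fillWords (rowBox lam mu) (fun j => p j + 1) w) := by
    simp only [B]
    rw [Basis.piTensorProduct_apply]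
    simp only [divBasis_apply]
    unfold gammaPiMonomial
    congr 1
    ext1 i
    have h1 := lineWord_fillWords (p := fun j => p j + 1) (rowBox lam mu) w i
    change _ = divMonomial _ Z _ hZ' (lineWord (rowBox lam mu) _ i)
    rw [h1]
  rw [h]
  exact thetaConj_gammaPiMonomial_mem_span hk hZ _ (isLineRestricted_fillWords _ w)

theorem linearIndependent_thetaConj (hk : (2 : k) ≠ 0) (hZ : ∀ i, Z i ∈ M.grading (p i)) :
    LinearIndependent k (fun t : {t : Tableau lam mu (Fin m) // IsCostandard p t} =>
      thetaConj M lam mu (gammaPiMonomial Z p hZ t.1)) := by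
  classical
  rw [Fintype.linearIndependent_iff]
  intro g hg
  -- With the zero subgroup of `k`: reading a linear relation at the column monomials of costandard
  -- tableaux gives a homogeneous unitriangular system, so all its coefficients vanish.
  refine mem_of_triangular (⊥ : AddSubgroup k)
    (fun t s : {t : Tableau lam mu (Fin m) // IsCostandard p t} => boxCoeff p t.1 s.1)
    (fun t => colWeight t.1) (fun t => boxCoeff_self_mul_self t.2)
    (fun t s h => (boxCoeff_triangular t.2 s.2 h).imp_left Subtype.ext) g fun s => ?_
  obtain ⟨w, hw⟩ := exists_fillWords_eq (colBox lam mu) s.1 s.2.restricted_col s.2.monotone_col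
  have h := DFunLike.congr_fun (congrArg (symConjBasis hk hZ lam mu).repr hg) w
  rw [map_sum, Finsupp.finsetSum_apply, map_zero, Finsupp.zero_apply] at h
  rw [AddSubgroup.mem_bot, ← h]
  refine Finset.sum_congr rfl fun t _ => ?_
  rw [map_smul, Finsupp.smul_apply, symConjBasis_repr_thetaConj, hw, zsmul_eq_mul, smul_eq_mul,
    mul_comm]

end Theta

end SuperSchur

theorem mainTheorem9 {k : Type u} [Field k] (hk : ringChar k ≠ 2)
    (V : SuperSchur.CliffordSupermodule.{u, v} k) (n : ℕ)
    (Z : Module.Basis (Fin (n + n)) k V.forget.carrier) (p : Fin (n + n) → ZMod 2)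
    (hZ : ∀ i, Z i ∈ V.forget.grading (p i))
    (lam mu : YoungDiagram) (hmu : mu ≤ lam) :
    ∃ B : Module.Basis
        {t : SuperSchur.Tableau lam mu (Fin (n + n)) // SuperSchur.IsCostandard p t} k
        (SuperSchur.schurConjII lam mu V),
      ∀ t, (B t : SuperSchur.SymConj V.forget lam mu) =
        SuperSchur.thetaConjII lam mu V (SuperSchur.gammaPiMonomial Z p hZ t.1) := by
  have h2 : (2 : k) ≠ 0 := Ring.two_ne_zero hk
  have hli := SuperSchur.linearIndependent_thetaConj (lam := lam) (mu := mu) h2 hZ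
  have hspan : SuperSchur.schurConjII lam mu V = _ := le_antisymm
    (SuperSchur.schurConj_le_span (lam := lam) (mu := mu) h2 hZ)
    (Submodule.span_le.2 (by rintro _ ⟨t, rfl⟩; exact ⟨_, rfl⟩))
  refine ⟨(Module.Basis.span hli).map (LinearEquiv.ofEq _ _ hspan.symm), fun t => ?_⟩
  rw [Module.Basis.map_apply, LinearEquiv.coe_ofEq_apply, Module.Basis.span_apply]
  rfl
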